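/- Let $d\in\{2,3\}$, $T>0$, let $D\subset\mathbb R^d$ be open and bounded, and let $\Omega_0$ be open with $C^2$ boundary and $\overline{\Omega_0}\subset D$ compact. Let $k\ge 2$ and let $\mathrm w\in C^1([0,T];C^k_c(D;\mathbb R^d))$ (the time derivative being taken in the $C^k$ norm) with $\operatorname{div}\mathrm w(t,\cdot)=0$ in $D$ for all $t\in[0,T]$. Let $\Phi_t$ be the flow of $\mathrm w$, i.e. $\frac{d}{dt}\Phi_t(x)=\mathrm w(t,\Phi_t(x))$, $\Phi_0(x)=x$, and put $\Omega(t)=\Phi_t(\Omega_0)$, $t\in[0,T]$, so $\Omega(0)=\Omega_0$. Define - $H(t)=\{u\in L^2(\Omega(t);\mathbb R^d):\int_{\Omega(t)}u\cdot\nabla q=0\ \forall q\in C^1_c(\Omega(t))\}$ with inner product $\int_{\Omega(t)}u\cdot v$; - $V(t)=\{u\in H^1_0(\Omega(t);\mathbb R^d):\operatorname{div}u=0\}$ with inner product $\int_{\Omega(t)}Du:Dv+u\cdot v$; - $V^*(t)=\{f\in H^{-1}(\Omega(t);\mathbb R^d):\langle f,\nabla q\rangle=0\ \forall q\in C^1_c(\Omega(t))\text{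 with }\nabla q\in H^1_0(\Omega(t);\mathbb R^d)\}$ with the norm of $H^{-1}(\Omega(t);\mathbb R^d)$, the dual of $H^1_0(\Omega(t);\mathbb R^d)$ normed by $\|v\|^2=\int_{\Omega(t)}|Dv|^2+|v|^2$. Let $\phi_t u=(D\Phi_t\,u)\circ\Phi_t^{-1}$ (Piola transform) for $u\in H(0)$, and in particular for $u\in V(0)$. For $f\in V^*(0)$ let $\phi_t f$ be defined by $\langle\phi_t f,v\rangle=\langle f,\phi_t^*v\rangle$ for all $v\in H^1_0(\Omega(t);\mathbb R^d)$, where $\phi_t^*v=D\Phi_t^{T}\,(v\circ\Phi_t)\in H^1_0(\Omega_0;\mathbb R^d)$. Then, with these maps, each of the pairs $(V^*,\phi)$, $(H,\phi)$ and $(V,\phi|_{V(0)})$ is well defined and compatible. That is, for $X=V^*,H,V$: 1. for every $t\in[0,T]$, $X(t)$ is a real separable Hilbert space, $\phi_t$ maps $X(0)$ into $X(t)$ and $\phi_t:X(0)\to X(t)$ is a linear homeomorphism, with $\phi_0=\mathrm{Id}$; 2. there is a constant $C_X$ independent of $t\in[0,T]$ with $\|\phi_tu\|_{X(t)}\le C_X\|u\|_{X(0)}$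 for all $u\in X(0)$ and $\|\phi_t^{-1}v\|_{X(0)}\le C_X\|v\|_{X(t)}$ for all $v\in X(t)$; 3. for every $u\in X(0)$ the map $t\mapsto\|\phi_tu\|_{X(t)}$ is continuous on $[0,T]$. -/

import Mathlib

open MeasureTheory Set Filter Topology

noncomputable section

namespace PiolaFlow

/-- The Euclidean space `ℝ^d`. -/
abbrev Vec (d : ℕ) : Type := EuclideanSpace ℝ (Fin d)

/-- Real `d × d` matrices with the Frobenius inner product `A : B = ∑ i j, A i j * B i j`. -/
abbrev Mat (d : ℕ) : Type := EuclideanSpace ℝ (Fin d × Fin d)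

variable {d : ℕ}

/-- The Jacobian matrix `Du`, with entries `(Du) i j = ∂_j u_i`. -/
def jac (u : Vec d → Vec d) (x : Vec d) : Mat d :=
  WithLp.toLp 2 fun p => fderiv ℝ u x (EuclideanSpace.single p.2 1) p.1

/-- The trace of a matrix, so that `div u = tr (Du)`. -/
def tr (A : Mat d) : ℝ := ∑ i, A (i, i)

/-- `f ∈ C^k_c(Ω)`: functions on `Ω` with compact support in `Ω`, extended by zero to `ℝ^d`. -/
structure IsCkc {F : Type*} [NormedAddCommGroup F] [NormedSpace ℝ F]
    (k : ℕ) (Ω : Set (Vec d)) (f : Vec d → F) : Prop where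
  contDiff : ContDiff ℝ k f
  compact : HasCompactSupport f
  subset : tsupport f ⊆ Ω

/-- `Ω` has a boundary of class `C²`: near each boundary point, `Ω` is the sublevel set `{ρ < 0}`
of a `C²` function `ρ` without critical points. -/
def HasC2Boundary (Ω : Set (Vec d)) : Prop :=
  ∀ x ∈ frontier Ω, ∃ U : Set (Vec d), IsOpen U ∧ x ∈ U ∧ ∃ ρ : Vec d → ℝ,
    ContDiffOn ℝ 2 ρ U ∧ (∀ y ∈ U, fderiv ℝ ρ y ≠ 0) ∧ ∀ y ∈ U, (y ∈ Ω ↔ ρ y < 0)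

/-! ### The velocity field, its flow and the moving domain -/

/-- `w ∈ C¹([0,T]; C^k_c(D; ℝ^d))`: the curve `t ↦ w(t,·)` takes values in `C^k_c(D; ℝ^d)` and has a
derivative `w'` with values in the same space, where difference quotients converge to `w'` and `w'`
is continuous in time with respect to the `C^k` norm, i.e. with uniform convergence of all spatial
derivatives up to order `k`. -/
def IsC1Ckc (T : ℝ) (k : ℕ) (D : Set (Vec d)) (w : ℝ → Vec d → Vec d) : Prop :=
  (∀ t ∈ Icc 0 T, IsCkc k D (w t)) ∧
  ∃ w' : ℝ → Vec d → Vec d, (∀ t ∈ Icc 0 T, IsCkc k D (w' t)) ∧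
    ∀ t ∈ Icc 0 T, ∀ j ≤ k,
      TendstoUniformly
        (fun s => iteratedFDeriv ℝ j (fun x => (s - t)⁻¹ • (w s x - w t x)))
        (iteratedFDeriv ℝ j (w' t)) (𝓝[Icc 0 T \ {t}] t) ∧
      TendstoUniformly (fun s => iteratedFDeriv ℝ j (w' s))
        (iteratedFDeriv ℝ j (w' t)) (𝓝[Icc 0 T] t)

/-- `γ` solves `γ' = w(t, γ)` on `[0,T]` with `γ(0) = x`. -/
def IsTrajectory (T : ℝ) (w : ℝ → Vec d → Vec d) (x : Vec d) (γ : ℝ → Vec d) : Prop :=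
  γ 0 = x ∧ ∀ t ∈ Icc 0 T, HasDerivWithinAt γ (w t (γ t)) (Icc 0 T) t

open Classical in
/-- The flow map `Φ_t = flow T w t` of `w`: the position at time `t ∈ [0,T]` of the trajectory that
starts in `x` (and `x` itself, should there be no trajectory). -/
def flow (T : ℝ) (w : ℝ → Vec d → Vec d) (t : ℝ) (x : Vec d) : Vec d :=
  if h : ∃ γ, IsTrajectory T w x γ then h.choose t else x

/-- The moving domain `Ω(t) = Φ_t(Ω₀)`. -/
def movingDomain (T : ℝ) (w : ℝ → Vec d → Vec d) (Ω₀ : Set (Vec d)) (t : ℝ) : Set (Vec d) :=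
  flow T w t '' Ω₀

/-- At time zero the moving domain is the initial domain. -/
theorem movingDomain_zero (T : ℝ) (w : ℝ → Vec d → Vec d) (Ω₀ : Set (Vec d)) :
    movingDomain T w Ω₀ 0 = Ω₀ := by
  have h : flow T w 0 = id := by
    funext x
    unfold flow
    split_ifs with h
    · exact h.choose_spec.1
    · rfl
  rw [movingDomain, h, image_id]

/-! ### Function spaces on a domain -/

/-- `L²(Ω; ℝ^d)`. -/
abbrev L2 (Ω : Set (Vec d)) : Type := Lp (Vec d) 2 (volume.restrict Ω)

/-- `L²(Ω; ℝ^{d×d})`. -/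
abbrev L2Mat (Ω : Set (Vec d)) : Type := Lp (Mat d) 2 (volume.restrict Ω)

/-- The Hilbert space of pairs `(u, G)`, with inner product `∫ u · v + ∫ G : K`. -/
abbrev L2Pair (Ω : Set (Vec d)) : Type := WithLp 2 (L2 Ω × L2Mat Ω)

theorem IsCkc.memLp_gradient {Ω : Set (Vec d)} {q : Vec d → ℝ} (hq : IsCkc 1 Ω q) :
    MemLp (gradient q) 2 (volume.restrict Ω) := by
  have hc : Continuous (gradient q) :=
    (InnerProductSpace.toDual ℝ (Vec d)).symm.continuous.comp
      (hq.contDiff.continuous_fderiv (by norm_num))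
  have hs : HasCompactSupport (gradient q) :=
    (hq.compact.fderiv (𝕜 := ℝ)).comp_left
      (g := (InnerProductSpace.toDual ℝ (Vec d)).symm) (map_zero _)
  exact (hc.memLp_of_hasCompactSupport hs).restrict _

theorem integrable_inner_gradient {Ω : Set (Vec d)} {q : Vec d → ℝ} (hq : IsCkc 1 Ω q)
    (u : L2 Ω) :
    Integrable (fun x => inner ℝ (u x) (gradient q x)) (volume.restrict Ω) := by
  refine (L2.integrable_inner (𝕜 := ℝ) u hq.memLp_gradient.toLp).congr ?_
  filter_upwards [hq.memLp_gradient.coeFn_toLp] with x hx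
  rw [hx]

/-- The space `H(Ω)` of weakly divergence free `u ∈ L²(Ω; ℝ^d)`: `∫_Ω u · ∇q = 0` for all
`q ∈ C¹_c(Ω)`. It carries the inner product `∫_Ω u · v` of `L²`. -/
def H (Ω : Set (Vec d)) : Submodule ℝ (L2 Ω) where
  carrier := {u | ∀ q : Vec d → ℝ, IsCkc 1 Ω q → ∫ x in Ω, inner ℝ (u x) (gradient q x) = 0}
  zero_mem' := by
    intro q _
    rw [integral_eq_zero_of_ae]
    filter_upwards [Lp.coeFn_zero (Vec d) 2 (volume.restrict Ω)] with x hx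
    rw [hx, Pi.zero_apply, inner_zero_left, Pi.zero_apply]
  add_mem' := by
    intro u v hu hv q hq
    have : ∫ x in Ω, inner ℝ ((u + v : L2 Ω) x) (gradient q x) =
        ∫ x in Ω, (inner ℝ (u x) (gradient q x) + inner ℝ (v x) (gradient q x)) := by
      apply integral_congr_ae
      filter_upwards [Lp.coeFn_add u v] with x hx
      rw [hx, Pi.add_apply, inner_add_left]
    rw [this, integral_add (integrable_inner_gradient hq u) (integrable_inner_gradient hq v),
      hu q hq, hv q hq, add_zero]
  smul_mem' := by
    intro c u hu q hq
    have : ∫ x in Ω, inner ℝ ((c • u : L2 Ω) x) (gradient q x) =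
        ∫ x in Ω, c * inner ℝ (u x) (gradient q x) := by
      apply integral_congr_ae
      filter_upwards [Lp.coeFn_smul c u] with x hx
      rw [hx, Pi.smul_apply, real_inner_smul_left]
    rw [this, integral_const_mul, hu q hq, mul_zero]

/-- The pairs `(u, Du)` with `u ∈ C¹_c(Ω; ℝ^d)`. -/
def smoothPairs (Ω : Set (Vec d)) : Submodule ℝ (L2Pair Ω) where
  carrier := {z | ∃ u : Vec d → Vec d, IsCkc 1 Ω u ∧
    z.fst =ᵐ[volume.restrict Ω] u ∧ z.snd =ᵐ[volume.restrict Ω] jac u}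
  zero_mem' := by
    refine ⟨0, ⟨contDiff_const, HasCompactSupport.zero, by simp [tsupport]⟩,
      Lp.coeFn_zero _ _ _, (Lp.coeFn_zero _ _ _).trans ?_⟩
    refine Eventually.of_forall fun x => ?_
    ext p
    simp [jac]
  add_mem' := by
    rintro y z ⟨u, hu, hu₁, hu₂⟩ ⟨v, hv, hv₁, hv₂⟩
    refine ⟨u + v, ⟨hu.contDiff.add hv.contDiff, hu.compact.add hv.compact,
      (tsupport_add u v).trans (union_subset hu.subset hv.subset)⟩, ?_, ?_⟩
    · filter_upwards [Lp.coeFn_add y.fst z.fst, hu₁, hv₁] with x hx h₁ h₂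
      rw [WithLp.add_fst, hx, Pi.add_apply, Pi.add_apply, h₁, h₂]
    · filter_upwards [Lp.coeFn_add y.snd z.snd, hu₂, hv₂] with x hx h₁ h₂
      rw [WithLp.add_snd, hx, Pi.add_apply, h₁, h₂]
      ext p
      simp [jac, fderiv_add (hu.contDiff.differentiable (by norm_num) x)
        (hv.contDiff.differentiable (by norm_num) x)]
  smul_mem' := by
    rintro c z ⟨u, hu, hu₁, hu₂⟩
    refine ⟨c • u, ⟨hu.contDiff.const_smul c, hu.compact.smul_left (f := fun _ => c),
      (tsupport_smul_subset_right (fun _ => c) u).trans hu.subset⟩, ?_, ?_⟩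
    · filter_upwards [Lp.coeFn_smul c z.fst, hu₁] with x hx h₁
      rw [WithLp.smul_fst, hx, Pi.smul_apply, Pi.smul_apply, h₁]
    · filter_upwards [Lp.coeFn_smul c z.snd, hu₂] with x hx h₁
      rw [WithLp.smul_snd, hx, Pi.smul_apply, h₁]
      ext p
      simp [jac, fderiv_const_smul (hu.contDiff.differentiable (by norm_num) x)]

/-- The Sobolev space `H¹₀(Ω; ℝ^d)`, the closure of `C¹_c(Ω; ℝ^d)` in the `H¹` norm. An element is
the pair `(u, Du)` of a function and its weak derivative, which `u` determines; the inner product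
is `∫_Ω u · v + Du : Dv`. -/
def H10 (Ω : Set (Vec d)) : Submodule ℝ (L2Pair Ω) := (smoothPairs Ω).topologicalClosure

/-- The space `V(Ω)` of `u ∈ H¹₀(Ω; ℝ^d)` with `div u = 0`, with the inner product of `H¹₀`. -/
def V (Ω : Set (Vec d)) : Submodule ℝ (L2Pair Ω) where
  carrier := {z | z ∈ H10 Ω ∧ ∀ᵐ x ∂(volume.restrict Ω), tr (z.snd x) = 0}
  zero_mem' := by
    refine ⟨zero_mem _, ?_⟩
    filter_upwards [Lp.coeFn_zero (Mat d) 2 (volume.restrict Ω)] with x hx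
    rw [WithLp.zero_snd, hx]
    simp [tr]
  add_mem' := by
    rintro y z ⟨hy, hy'⟩ ⟨hz, hz'⟩
    refine ⟨add_mem hy hz, ?_⟩
    filter_upwards [Lp.coeFn_add y.snd z.snd, hy', hz'] with x hx h₁ h₂
    rw [WithLp.add_snd, hx]
    simp only [tr] at h₁ h₂ ⊢
    simp [Finset.sum_add_distrib, h₁, h₂]
  smul_mem' := by
    rintro c z ⟨hz, hz'⟩
    refine ⟨Submodule.smul_mem _ c hz, ?_⟩
    filter_upwards [Lp.coeFn_smul c z.snd, hz'] with x hx h₁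
    rw [WithLp.smul_snd, hx]
    simp only [tr] at h₁ ⊢
    simp [← Finset.mul_sum, h₁]

/-- The space `H⁻¹(Ω; ℝ^d)`, the dual of `H¹₀(Ω; ℝ^d)` with the dual norm. -/
abbrev HNeg1 (Ω : Set (Vec d)) : Type := StrongDual ℝ (H10 Ω)

/-- The space `V*(Ω)` of weakly divergence free `f ∈ H⁻¹(Ω; ℝ^d)`, with the norm of `H⁻¹`:
`⟨f, ∇q⟩ = 0` for all `q ∈ C¹_c(Ω)` for which the pairing makes sense, that is, with
`∇q ∈ H¹₀(Ω; ℝ^d)`. -/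
def VStar (Ω : Set (Vec d)) : Submodule ℝ (HNeg1 Ω) where
  carrier := {f | ∀ q : Vec d → ℝ, IsCkc 1 Ω q → ∀ g : H10 Ω,
    g.1.fst =ᵐ[volume.restrict Ω] gradient q → f g = 0}
  zero_mem' := by
    intro q _ g _
    rfl
  add_mem' := by
    intro f₁ f₂ h₁ h₂ q hq g hg
    rw [add_apply, h₁ q hq g hg, h₂ q hq g hg, add_zero]
  smul_mem' := by
    intro c f hf q hq g hg
    rw [smul_apply, hf q hq g hg, smul_zero]

/-! ### Piola transforms -/

/-- The contravariant Piola transform `(DΨ u) ∘ Ψ⁻¹` along `Ψ : Ω₀ → Ψ(Ω₀)`. -/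
def piola (Ω₀ : Set (Vec d)) (Ψ : Vec d → Vec d) (u : Vec d → Vec d) (y : Vec d) : Vec d :=
  fderiv ℝ Ψ (Function.invFunOn Ψ Ω₀ y) (u (Function.invFunOn Ψ Ω₀ y))

/-- The covariant Piola transform `DΨᵀ (v ∘ Ψ)`, dual to `piola`. -/
def coPiola (Ψ : Vec d → Vec d) (v : Vec d → Vec d) (x : Vec d) : Vec d :=
  ContinuousLinearMap.adjoint (fderiv ℝ Ψ x) (v (Ψ x))

/-- For `t ∈ [0,T]`, `φ_t` is the Piola transform along `Φ_t` on `H(Ω(0))`. -/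
def IsPiolaH (T : ℝ) (w : ℝ → Vec d → Vec d) (Ω₀ : Set (Vec d))
    (φ : ∀ t : ℝ, H (movingDomain T w Ω₀ 0) → H (movingDomain T w Ω₀ t)) : Prop :=
  ∀ t ∈ Icc 0 T, ∀ u,
    (φ t u).1 =ᵐ[volume.restrict (movingDomain T w Ω₀ t)] piola Ω₀ (flow T w t) u.1

/-- For `t ∈ [0,T]`, `φ_t` is the Piola transform along `Φ_t` on `V(Ω(0))`. -/
def IsPiolaV (T : ℝ) (w : ℝ → Vec d → Vec d) (Ω₀ : Set (Vec d))
    (φ : ∀ t : ℝ, V (movingDomain T w Ω₀ 0) → V (movingDomain T w Ω₀ t)) : Prop :=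
  ∀ t ∈ Icc 0 T, ∀ u,
    (φ t u).1.fst =ᵐ[volume.restrict (movingDomain T w Ω₀ t)] piola Ω₀ (flow T w t) u.1.fst

/-- For `t ∈ [0,T]`, `φ_t` is the Piola transform on `V*(Ω(0))`, defined by duality:
`⟨φ_t f, v⟩ = ⟨f, φ_t* v⟩` for all `v ∈ H¹₀(Ω(t); ℝ^d)`, where
`φ_t* : H¹₀(Ω(t); ℝ^d) → H¹₀(Ω(0); ℝ^d)` (here `S`) is the covariant Piola transform along `Φ_t`. -/
def IsPiolaVStar (T : ℝ) (w : ℝ → Vec d → Vec d) (Ω₀ : Set (Vec d))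
    (φ : ∀ t : ℝ, VStar (movingDomain T w Ω₀ 0) → VStar (movingDomain T w Ω₀ t)) : Prop :=
  ∀ t ∈ Icc 0 T, ∃ S : H10 (movingDomain T w Ω₀ t) → H10 (movingDomain T w Ω₀ 0),
    (∀ v, (S v).1.fst =ᵐ[volume.restrict (movingDomain T w Ω₀ 0)]
      coPiola (flow T w t) v.1.fst) ∧
    ∀ f v, (φ t f).1 v = f.1 (S v)

/-! ### Compatibility -/

/-- A normed space is a separable Hilbert space: complete, separable, and its norm comes from an
inner product. -/
structure IsSeparableHilbert (X : Type*) [NormedAddCommGroup X] [NormedSpace ℝ X] : Prop where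
  complete : CompleteSpace X
  separable : TopologicalSpace.SeparableSpace X
  inner : ∃ B : X →ₗ[ℝ] X →ₗ[ℝ] ℝ, (∀ x y, B x y = B y x) ∧ ∀ x, B x x = ‖x‖ ^ 2

/-- Compatibility of the pair `(X, (φ_t)_t)` over `[0,T]`. -/
structure IsCompatible (T : ℝ) (X : ℝ → Type*) [∀ t, NormedAddCommGroup (X t)]
    [∀ t, NormedSpace ℝ (X t)] (φ : ∀ t, X 0 → X t) : Prop where
  hilbert : ∀ t ∈ Icc 0 T, IsSeparableHilbert (X t)
  map_zero : ∀ u, φ 0 u = u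
  homeomorph : ∃ C : ℝ, ∀ t ∈ Icc 0 T, ∃ e : X 0 ≃L[ℝ] X t, (∀ u, e u = φ t u) ∧
    (∀ u, ‖e u‖ ≤ C * ‖u‖) ∧ ∀ v, ‖e.symm v‖ ≤ C * ‖v‖
  continuous_norm : ∀ u, ContinuousOn (fun t => ‖φ t u‖) (Icc 0 T)

end PiolaFlow

end

open PiolaFlow

namespace PiolaFlow

/-! ### Ordinary differential equations -/

section ODE

open scoped NNReal

variable {E F X : Type*} [NormedAddCommGroup E] [NormedSpace ℝ E]
  [NormedAddCommGroup F] [NormedSpace ℝ F]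

/-! Everything is transported to the initial domain. The field `w` and its first two spatial
derivatives are bounded and jointly continuous, so each `Φ_t` is a `C²` diffeomorphism of `ℝ^d`,
with `DΦ_t` and `D²Φ_t` jointly continuous in `(t, x)` (`exists_hasFDerivAt_fderiv_flow`), and `div
w = 0` forces `det DΦ_t = 1` (`det_fderiv_flow`). Hence `v ↦ v ∘ Φ_t` is an isometry `J_t` from
`L²(Ω(t))` onto `L²(Ω(0))`, and the inverse Piola transform is `Q_t J_t`, where `Q_t` is
multiplication by `N = DΦ_t⁻¹` on a space that does not depend on `t`. On pairs `(v, Dv)` the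
product and chain rules turn `Q_t` into a triangular operator with coefficients `N`, `DN` and `G ↦ N
G DΦ_t`.

These coefficients vary continuously in `t`, uniformly on the compact closure of `Ω₀`, so `Q_t` is
continuous in operator norm. Inversion of operators is continuous, hence so is `Q_t⁻¹`. Since `‖φ_t
u‖ = ‖Q_t⁻¹ u‖`, the uniform bounds and the continuity of norms follow from compactness of `[0,T]`
(`isPullFamily_restrict`).

It remains to see that `Q_t J_t` matches the subspaces. For `H` this is the change of variables
together with `∇(q ∘ Φ) = DΦᵀ (∇q ∘ Φ)` (`pull_mem_H_iff`). For `H¹₀` the `C¹_c` functions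
correspond to each other, hence so do their closures (`sobPull_mem_H10_iff`). For `V` the divergence
is carried along, because differentiating `det DΦ = 1` makes the zeroth order term traceless
(`sobPull_mem_V_iff`).

For `V*` the same scheme is run on `H¹₀` with `N = DΦ_tᵀ`, which maps gradients to gradients, and is
then dualized. Continuity of the dual norms survives because the norms on `H¹₀` vary continuously in
`t` uniformly on bounded sets (`norm_dualEquiv_symm_le`). -/

theorem hasDerivWithinAt_Ici_of_Icc {γ : ℝ → E} {γ' : E} {a b t : ℝ}
    (h : HasDerivWithinAt γ γ' (Icc a b) t) (ht : t ∈ Ico a b) :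
    HasDerivWithinAt γ γ' (Ici t) t :=
  h.mono_of_mem_nhdsWithin (Icc_mem_nhdsGE_of_mem ht)

theorem hasDerivWithinAt_Iic_of_Icc {γ : ℝ → E} {γ' : E} {a b t : ℝ}
    (h : HasDerivWithinAt γ γ' (Icc a b) t) (ht : t ∈ Ioc a b) :
    HasDerivWithinAt γ γ' (Iic t) t :=
  h.mono_of_mem_nhdsWithin (Icc_mem_nhdsLE_of_mem ht)

/-- A curve of speed at most `L` stays within distance `L (b - a)` of its starting point, so
Picard–Lindelöf on the ball of this radius already covers the whole interval. -/
theorem exists_integralCurve_of_lipschitz_of_bounded [CompleteSpace E] {f : ℝ → E → E} {a b t₀ : ℝ}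
    {K L : ℝ≥0} (hlip : ∀ t ∈ Icc a b, LipschitzWith K (f t))
    (hcont : ∀ x, ContinuousOn (fun t => f t x) (Icc a b))
    (hbd : ∀ t ∈ Icc a b, ∀ x, ‖f t x‖ ≤ L) (ht₀ : t₀ ∈ Icc a b) (x : E) :
    ∃ γ : ℝ → E, γ t₀ = x ∧ IsIntegralCurveOn γ f (Icc a b) := by
  have hab : 0 ≤ b - a := by linarith [ht₀.1, ht₀.2]
  have hp : IsPicardLindelof f (⟨t₀, ht₀⟩ : Icc a b) x (L * ⟨b - a, hab⟩) 0 L K :=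
    { lipschitzOnWith := fun t ht => (hlip t ht).lipschitzOnWith
      continuousOn := fun y _ => hcont y
      norm_le := fun t ht y _ => hbd t ht y
      mul_max_le := by
        have : max (b - t₀) (t₀ - a) ≤ b - a := by
          apply max_le <;> linarith [ht₀.1, ht₀.2]
        simpa using! mul_le_mul_of_nonneg_left this L.2 }
  exact hp.exists_eq_forall_mem_Icc_hasDerivWithinAt₀

/-- Uniqueness runs both forwards and backwards from `t₀`; the backward half is what makes the flow
maps injective. -/
theorem IsIntegralCurveOn.eqOn_of_lipschitz {f : ℝ → E → E} {a b t₀ : ℝ} {K : ℝ≥0}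
    (hlip : ∀ t ∈ Icc a b, LipschitzWith K (f t)) {γ η : ℝ → E}
    (hγ : IsIntegralCurveOn γ f (Icc a b)) (hη : IsIntegralCurveOn η f (Icc a b))
    (ht₀ : t₀ ∈ Icc a b) (h : γ t₀ = η t₀) : EqOn γ η (Icc a b) := by
  have hγc : ContinuousOn γ (Icc a b) := fun t ht => (hγ t ht).continuousWithinAt
  have hηc : ContinuousOn η (Icc a b) := fun t ht => (hη t ht).continuousWithinAt
  have hl : Icc a t₀ ⊆ Icc a b := Icc_subset_Icc_right ht₀.2
  have hr : Icc t₀ b ⊆ Icc a b := Icc_subset_Icc_left ht₀.1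
  have hl' : ∀ t ∈ Ioc a t₀, t ∈ Ioc a b := fun t ht => ⟨ht.1, ht.2.trans ht₀.2⟩
  have hr' : ∀ t ∈ Ico t₀ b, t ∈ Ico a b := fun t ht => ⟨ht₀.1.trans ht.1, ht.2⟩
  rw [← Icc_union_Icc_eq_Icc ht₀.1 ht₀.2]
  apply EqOn.union
  · exact ODE_solution_unique_of_mem_Icc_left (s := fun _ => univ) (K := K)
      (fun t ht => (hlip t (Ioc_subset_Icc_self (hl' t ht))).lipschitzOnWith)
      (hγc.mono hl)
      (fun t ht => hasDerivWithinAt_Iic_of_Icc (hγ t (Ioc_subset_Icc_self (hl' t ht))) (hl' t ht))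
      (fun _ _ => trivial) (hηc.mono hl)
      (fun t ht => hasDerivWithinAt_Iic_of_Icc (hη t (Ioc_subset_Icc_self (hl' t ht))) (hl' t ht))
      (fun _ _ => trivial) h
  · exact ODE_solution_unique_of_mem_Icc_right (s := fun _ => univ) (K := K)
      (fun t ht => (hlip t (Ico_subset_Icc_self (hr' t ht))).lipschitzOnWith)
      (hγc.mono hr)
      (fun t ht => hasDerivWithinAt_Ici_of_Icc (hγ t (Ico_subset_Icc_self (hr' t ht))) (hr' t ht))
      (fun _ _ => trivial) (hηc.mono hr)
      (fun t ht => hasDerivWithinAt_Ici_of_Icc (hη t (Ico_subset_Icc_self (hr' t ht))) (hr' t ht))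
      (fun _ _ => trivial) h

/-- A uniform form of Grönwall's inequality. -/
theorem norm_le_two_mul_exp_of_deriv_le {e e' : ℝ → E} {T K δ : ℝ} (hK : 1 ≤ K) (hδ : 0 ≤ δ)
    (he : ∀ t ∈ Icc 0 T, HasDerivWithinAt e (e' t) (Icc 0 T) t) (h0 : ‖e 0‖ ≤ δ)
    (hb : ∀ t ∈ Icc 0 T, ‖e' t‖ ≤ K * ‖e t‖ + δ) :
    ∀ t ∈ Icc 0 T, ‖e t‖ ≤ 2 * δ * Real.exp (K * T) := by
  intro t ht
  have h := norm_le_gronwallBound_of_norm_deriv_right_le (a := 0) (b := T)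
    (fun t ht => (he t ht).continuousWithinAt)
    (fun t ht => hasDerivWithinAt_Ici_of_Icc (he t (Ico_subset_Icc_self ht)) ht) h0
    (fun t ht => hb t (Ico_subset_Icc_self ht)) t ht
  refine h.trans ?_
  rw [gronwallBound_of_K_ne_0 (by positivity), sub_zero]
  have h1 : Real.exp (K * t) ≤ Real.exp (K * T) :=
    Real.exp_le_exp.2 (mul_le_mul_of_nonneg_left ht.2 (by linarith))
  -- This is where `1 ≤ K` enters: the resulting constant is free of `1 / K`.
  have h2 : δ / K ≤ δ := div_le_self hδ hK
  have h3 : δ / K * (Real.exp (K * t) - 1) ≤ δ * Real.exp (K * T) := by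
    have : 0 ≤ δ / K := by positivity
    calc δ / K * (Real.exp (K * t) - 1) ≤ δ / K * Real.exp (K * T) := by gcongr; linarith
      _ ≤ _ := by gcongr
  have h4 : δ * Real.exp (K * t) ≤ δ * Real.exp (K * T) := by gcongr
  linarith

/-- Linear equations have solutions on the whole time interval. -/
theorem exists_integralCurve_linear [FiniteDimensional ℝ F] {A : ℝ → F →L[ℝ] F} {T : ℝ}
    (hT : 0 ≤ T) (hA : ContinuousOn A (Icc 0 T)) (x : F) :
    ∃ γ : ℝ → F, γ 0 = x ∧ IsIntegralCurveOn γ (fun t y => A t y) (Icc 0 T) := by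
  obtain ⟨K, hK⟩ := isCompact_Icc.exists_bound_of_continuousOn hA
  have hK0 : 0 ≤ K := (norm_nonneg _).trans (hK 0 ⟨le_rfl, hT⟩)
  -- The Grönwall bound for the linear equation, plus one for positivity. Cutting the field off
  -- outside the ball of radius `R` makes it bounded and Lipschitz; the solution obeys the same
  -- bound, hence never sees the cutoff.
  set R : ℝ := ‖x‖ * Real.exp (K * T) + 1 with hR
  have hRp : 0 < R := by positivity
  let χ : ContDiffBump (0 : F) := ⟨R, R + 1, hRp, by linarith⟩
  let g : F → F := fun v => χ v • v
  have hgc : ContDiff ℝ 1 g := χ.contDiff.smul contDiff_id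
  have hgs : HasCompactSupport g := χ.hasCompactSupport.smul_right
  obtain ⟨C, hC⟩ := hgc.lipschitzWith_of_hasCompactSupport hgs one_ne_zero
  obtain ⟨M, hM⟩ := hgs.exists_bound_of_continuous hgc.continuous
  have hM0 : 0 ≤ M := (norm_nonneg _).trans (hM 0)
  have hl : ∀ t ∈ Icc 0 T, LipschitzWith (⟨K, hK0⟩ * C) (fun v => A t (g v)) := fun t ht =>
    ((A t).lipschitz.weaken (show ‖A t‖₊ ≤ ⟨K, hK0⟩ from hK t ht)).comp hC
  obtain ⟨γ, h0, hγ⟩ := exists_integralCurve_of_lipschitz_of_bounded (f := fun t v => A t (g v))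
    (L := ⟨K * M, by positivity⟩) hl (fun v => hA.clm_apply continuousOn_const)
    (fun t ht v => (A t).le_of_opNorm_le_of_le (hK t ht) (hM v)) (t₀ := 0) ⟨le_rfl, hT⟩ x
  have hb : ∀ t ∈ Icc 0 T, ‖γ t‖ ≤ R := by
    intro t ht
    have := norm_le_gronwallBound_of_norm_deriv_right_le (δ := ‖x‖) (K := K) (ε := 0)
      (fun t ht => (hγ t ht).continuousWithinAt)
      (fun t ht => hasDerivWithinAt_Ici_of_Icc (hγ t (Ico_subset_Icc_self ht)) ht) (by rw [h0])
      (fun t ht => ?_) t ht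
    · rw [gronwallBound_ε0, sub_zero] at this
      refine this.trans ?_
      have : Real.exp (K * t) ≤ Real.exp (K * T) :=
        Real.exp_le_exp.2 (mul_le_mul_of_nonneg_left ht.2 hK0)
      rw [hR]
      nlinarith [norm_nonneg x]
    · rw [add_zero]
      refine (A t).le_of_opNorm_le_of_le (hK t (Ico_subset_Icc_self ht)) ?_
      rw [norm_smul, Real.norm_of_nonneg χ.nonneg]
      exact mul_le_of_le_one_left (norm_nonneg _) χ.le_one
  refine ⟨γ, h0, fun t ht => ?_⟩
  have h1 : g (γ t) = γ t := by
    have : χ (γ t) = 1 := χ.one_of_mem_closedBall (by simpa using hb t ht)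
    simp [g, this]
  simpa only [h1] using hγ t ht

/-- A tube lemma: near each `(z₀, y)` both `A (z, ·)` and `A (z₀, ·)` are within `ε / 2` of `A (z₀,
y)`, and compactness of `K` leaves finitely many such neighbourhoods. Only relative continuity on `S
×ˢ K` is available, which is why membership is carried through the argument. -/
theorem _root_.IsCompact.eventually_forall_dist_lt {Y Z G : Type*} [TopologicalSpace Y]
    [TopologicalSpace Z] [PseudoMetricSpace G] {S : Set Z} {K : Set Y} (hK : IsCompact K)
    {A : Z × Y → G} (hA : ContinuousOn A (S ×ˢ K)) {z₀ : Z} (hz₀ : z₀ ∈ S) {ε : ℝ} (hε : 0 < ε) :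
    ∀ᶠ z in 𝓝[S] z₀, ∀ y ∈ K, dist (A (z, y)) (A (z₀, y)) < ε := by
  rw [eventually_nhdsWithin_iff]
  have key : ∀ᶠ z in 𝓝 z₀, ∀ y ∈ K, y ∈ K → z ∈ S → dist (A (z, y)) (A (z₀, y)) < ε := by
    refine hK.eventually_forall_of_forall_eventually
      (P := fun z y => y ∈ K → z ∈ S → dist (A (z, y)) (A (z₀, y)) < ε) fun y hy => ?_
    have h1 := (Metric.tendsto_nhds.1 (hA (z₀, y) ⟨hz₀, hy⟩)) (ε / 2) (by positivity)
    rw [eventually_nhdsWithin_iff] at h1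
    have h2 : Tendsto (fun p : Z × Y => (z₀, p.2)) (𝓝 (z₀, y)) (𝓝 (z₀, y)) :=
      (by fun_prop : Continuous fun p : Z × Y => (z₀, p.2)).tendsto' _ _ rfl
    filter_upwards [h1, h2.eventually h1] with p hp1 hp2 hpK hpS
    have e1 := hp1 ⟨hpS, hpK⟩
    have e2 := hp2 ⟨hz₀, hpK⟩
    have := dist_triangle_right (A (p.1, p.2)) (A (z₀, p.2)) (A (z₀, y))
    simp only [Prod.mk.eta] at this ⊢
    linarith
  filter_upwards [key] with z hz hzS y hy using hz y hy hy hzS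

variable [TopologicalSpace X]

/-- Solutions of linear equations depend continuously on parameters. -/
theorem continuousOn_integralCurve_linear {A : ℝ → X → F →L[ℝ] F} {T : ℝ} (hT : 0 ≤ T)
    (hA : ContinuousOn (fun p : ℝ × X => A p.1 p.2) (Icc 0 T ×ˢ univ)) {J : X → ℝ → F}
    (hJ : ∀ x, IsIntegralCurveOn (J x) (fun t y => A t x y) (Icc 0 T))
    (h0 : Continuous fun x => J x 0) :
    ContinuousOn (fun p : ℝ × X => J p.2 p.1) (Icc 0 T ×ˢ univ) := by
  rintro ⟨t₀, x₀⟩ ⟨ht₀, -⟩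
  have hJc : ∀ x, ContinuousOn (J x) (Icc 0 T) := fun x t ht => (hJ x t ht).continuousWithinAt
  obtain ⟨B, hB⟩ := isCompact_Icc.exists_bound_of_continuousOn (hJc x₀)
  have hA₀ : ContinuousOn (fun t => A t x₀) (Icc 0 T) :=
    hA.comp (f := fun t => (t, x₀)) (by fun_prop) fun t ht => ⟨ht, trivial⟩
  obtain ⟨K, hK⟩ := isCompact_Icc.exists_bound_of_continuousOn hA₀
  have h00 : (0 : ℝ) ∈ Icc 0 T := ⟨le_rfl, hT⟩
  have hB0 : 0 ≤ B := (norm_nonneg _).trans (hB 0 h00)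
  have hK0 : 0 ≤ K := (norm_nonneg _).trans (hK 0 h00)
  have hA' : ContinuousOn (fun p : X × ℝ => A p.2 p.1) (univ ×ˢ Icc 0 T) :=
    hA.comp (f := fun p : X × ℝ => (p.2, p.1)) (by fun_prop) fun p hp => ⟨hp.2, trivial⟩
  have hun : ∀ δ > 0, δ ≤ 1 → ∀ᶠ x in 𝓝 x₀, ∀ t ∈ Icc 0 T,
      ‖J x t - J x₀ t‖ ≤ 2 * (δ * (B + 1)) * Real.exp ((K + 1) * T) := by
    intro δ hδ hδ1
    have h1 := isCompact_Icc.eventually_forall_dist_lt hA' (mem_univ x₀) hδ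
    rw [nhdsWithin_univ] at h1
    have h2 := (Metric.tendsto_nhds.1 (h0.tendsto x₀)) δ hδ
    filter_upwards [h1, h2] with x hx1 hx2
    refine norm_le_two_mul_exp_of_deriv_le (e := fun t => J x t - J x₀ t) (by linarith)
      (by positivity) (fun t ht => (hJ x t ht).sub (hJ x₀ t ht)) ?_ ?_
    · rw [← dist_eq_norm]; nlinarith
    · intro t ht
      -- The difference of two solutions solves the equation of `x` with inhomogeneity `(A t x - A t
      -- x₀) (J x₀ t)`, of size at most `δ B`.
      have e1 : A t x (J x t) - A t x₀ (J x₀ t)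
          = A t x (J x t - J x₀ t) + (A t x - A t x₀) (J x₀ t) := by
        simp
      have e2 : ‖A t x - A t x₀‖ ≤ δ := by rw [← dist_eq_norm]; exact (hx1 t ht).le
      have e3 : ‖A t x‖ ≤ K + 1 := by
        have := norm_le_norm_add_norm_sub' (A t x) (A t x₀)
        linarith [hK t ht]
      rw [e1]
      refine (norm_add_le _ _).trans (add_le_add ((A t x).le_of_opNorm_le e3 _) ?_)
      refine ((A t x - A t x₀).le_of_opNorm_le_of_le e2 (hB t ht)).trans ?_
      nlinarith
  refine Metric.tendsto_nhds.2 fun ε hε => ?_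
  obtain ⟨δ, hδ, hδ1, hδε⟩ : ∃ δ > 0, δ ≤ 1 ∧
      2 * (δ * (B + 1)) * Real.exp ((K + 1) * T) < ε / 2 := by
    set M := 2 * (B + 1) * Real.exp ((K + 1) * T) with hM
    have hMp : 0 < M := by positivity
    refine ⟨min 1 (ε / 4 / M), by positivity, min_le_left _ _, ?_⟩
    calc 2 * (min 1 (ε / 4 / M) * (B + 1)) * Real.exp ((K + 1) * T)
        = min 1 (ε / 4 / M) * M := by rw [hM]; ring
      _ ≤ ε / 4 / M * M := by gcongr; exact min_le_right _ _
      _ = ε / 4 := by field_simp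
      _ < ε / 2 := by linarith
  have h1 : ∀ᶠ p : ℝ × X in 𝓝[Icc 0 T ×ˢ univ] (t₀, x₀), ∀ t ∈ Icc 0 T,
      ‖J p.2 t - J x₀ t‖ ≤ 2 * (δ * (B + 1)) * Real.exp ((K + 1) * T) :=
    ((continuous_snd.tendsto (t₀, x₀)).mono_left nhdsWithin_le_nhds).eventually (hun δ hδ hδ1)
  have h2 : ContinuousWithinAt (fun p : ℝ × X => J x₀ p.1) (Icc 0 T ×ˢ univ) (t₀, x₀) :=
    (hJc x₀).comp continuous_fst.continuousOn (fun p hp => hp.1) _ ⟨ht₀, trivial⟩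
  filter_upwards [h1, Metric.tendsto_nhds.1 h2 (ε / 2) (by positivity), self_mem_nhdsWithin]
    with p hp1 hp2 hp3
  refine (dist_triangle _ (J x₀ p.1) _).trans_lt ?_
  have := hp1 p.1 hp3.1
  rw [← dist_eq_norm] at this
  linarith

/-- Solutions depend differentiably on parameters, and the derivative solves the linearized
equation. -/
theorem hasFDerivAt_integralCurve {X : Type*} [NormedAddCommGroup X] [NormedSpace ℝ X]
    {f : ℝ → E → E} {f' : ℝ → E → E →L[ℝ] E} {T L : ℝ}
    (hf : ∀ t ∈ Icc 0 T, ∀ y, HasFDerivAt (f t) (f' t y) y)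
    (hf' : ContinuousOn (fun p : ℝ × E => f' p.1 p.2) (Icc 0 T ×ˢ univ)) {γ : X → ℝ → E}
    (hγ : ∀ x, IsIntegralCurveOn (γ x) f (Icc 0 T)) {x₀ : X}
    (hL : ∀ᶠ x in 𝓝 x₀, ∀ t ∈ Icc 0 T, ‖γ x t - γ x₀ t‖ ≤ L * ‖x - x₀‖) {J : ℝ → X →L[ℝ] E}
    (hJ : ∀ t ∈ Icc 0 T, HasDerivWithinAt J (f' t (γ x₀ t) ∘L J t) (Icc 0 T) t)
    (h0 : HasFDerivAt (fun x => γ x 0) (J 0) x₀) {t : ℝ} (ht : t ∈ Icc 0 T) :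
    HasFDerivAt (fun x => γ x t) (J t) x₀ := by
  have hT : 0 ≤ T := ht.1.trans ht.2
  have hγc : ContinuousOn (γ x₀) (Icc 0 T) := fun t ht => (hγ x₀ t ht).continuousWithinAt
  have hA₀ : ContinuousOn (fun t => f' t (γ x₀ t)) (Icc 0 T) :=
    hf'.comp (f := fun t => (t, γ x₀ t)) (by fun_prop) fun t ht => ⟨ht, trivial⟩
  obtain ⟨K, hK⟩ := isCompact_Icc.exists_bound_of_continuousOn hA₀
  have hK0 : 0 ≤ K := (norm_nonneg _).trans (hK t ht)
  wlog hL0 : 0 ≤ L generalizing L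
  · refine this (L := 0) ?_ le_rfl
    filter_upwards [hL] with x hx t ht
    exact (hx t ht).trans (by gcongr; linarith)
  -- Recentring at the curve `γ x₀` lets compactness of `[0,T]` produce one radius `ρ` that works
  -- along the whole curve.
  have hA' : ContinuousOn (fun p : E × ℝ => f' p.2 (γ x₀ p.2 + p.1)) (univ ×ˢ Icc 0 T) :=
    hf'.comp (f := fun p : E × ℝ => (p.2, γ x₀ p.2 + p.1)) (continuousOn_snd.prodMk
      ((hγc.comp continuousOn_snd fun p hp => hp.2).add continuousOn_fst))
      fun p hp => ⟨hp.2, trivial⟩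
  rw [hasFDerivAt_iff_isLittleO, Asymptotics.isLittleO_iff]
  intro c hc
  set M := 2 * (L + 1) * Real.exp ((K + 1) * T) with hM
  have hMp : 0 < M := by positivity
  set ε := c / M with hε
  have hεp : 0 < ε := by positivity
  have h1 := isCompact_Icc.eventually_forall_dist_lt hA' (mem_univ (0 : E)) hεp
  rw [nhdsWithin_univ, Metric.eventually_nhds_iff_ball] at h1
  obtain ⟨ρ, hρ, h1⟩ := h1
  have h2 : ∀ᶠ x in 𝓝 x₀, L * ‖x - x₀‖ < ρ := by
    have : Tendsto (fun x => L * ‖x - x₀‖) (𝓝 x₀) (𝓝 0) :=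
      (by fun_prop : Continuous fun x => L * ‖x - x₀‖).tendsto' _ _ (by simp)
    exact this.eventually_lt_const hρ
  have h3 := (Asymptotics.isLittleO_iff.1 (hasFDerivAt_iff_isLittleO.1 h0)) hεp
  filter_upwards [hL, h2, h3] with x hxL hxρ hx0
  have hJx : ∀ s ∈ Icc 0 T, HasDerivWithinAt (fun s => J s (x - x₀))
      (f' s (γ x₀ s) (J s (x - x₀))) (Icc 0 T) s := fun s hs => by
    simpa using (hJ s hs).clm_apply (hasDerivWithinAt_const s (Icc 0 T) (x - x₀))
  have := norm_le_two_mul_exp_of_deriv_le (e := fun s => γ x s - γ x₀ s - J s (x - x₀))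
    (K := K + 1) (δ := ε * (L + 1) * ‖x - x₀‖) (by linarith) (by positivity)
    (fun s hs => ((hγ x s hs).sub (hγ x₀ s hs)).sub (hJx s hs))
    (hx0.trans (by gcongr; nlinarith)) (fun s hs => ?_) t ht
  · refine this.trans_eq ?_
    calc 2 * (ε * (L + 1) * ‖x - x₀‖) * Real.exp ((K + 1) * T) = ε * M * ‖x - x₀‖ := by
          rw [hM]; ring
      _ = c * ‖x - x₀‖ := by rw [hε]; field_simp
  · have e1 : f s (γ x s) - f s (γ x₀ s) - f' s (γ x₀ s) (J s (x - x₀))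
        = f' s (γ x₀ s) (γ x s - γ x₀ s - J s (x - x₀))
          + (f s (γ x s) - f s (γ x₀ s) - f' s (γ x₀ s) (γ x s - γ x₀ s)) := by
      simp only [map_sub]; abel
    -- Mean value inequality on the ball of radius `ρ` around `γ x₀ s`, where `f' s` differs from
    -- its value at the centre by at most `ε`.
    have e2 : ‖f s (γ x s) - f s (γ x₀ s) - f' s (γ x₀ s) (γ x s - γ x₀ s)‖
        ≤ ε * ‖γ x s - γ x₀ s‖ := by
      refine (convex_ball (γ x₀ s) ρ).norm_image_sub_le_of_norm_hasFDerivWithin_le'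
        (fun y _ => (hf s hs y).hasFDerivWithinAt) (fun y hy => ?_)
        (Metric.mem_ball_self hρ) (by
          rw [mem_ball_iff_norm]; exact (hxL s hs).trans_lt hxρ)
      have := h1 (y - γ x₀ s) (by rw [mem_ball_zero_iff]; exact mem_ball_iff_norm.1 hy) s hs
      simpa [dist_eq_norm] using this.le
    rw [e1]
    refine (norm_add_le _ _).trans (add_le_add ((ContinuousLinearMap.le_of_opNorm_le _
      ((hK s hs).trans (by linarith))) _) (e2.trans ?_))
    calc ε * ‖γ x s - γ x₀ s‖ ≤ ε * (L * ‖x - x₀‖) := by gcongr; exact hxL s hs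
      _ ≤ ε * (L + 1) * ‖x - x₀‖ := by nlinarith [mul_nonneg hεp.le (norm_nonneg (x - x₀))]

/-- A family of solutions that is Lipschitz in a parameter is continuously differentiable in this
parameter, and its derivative solves the linearized equation. -/
theorem exists_hasFDerivAt_integralCurve {X : Type*} [NormedAddCommGroup X] [NormedSpace ℝ X]
    [FiniteDimensional ℝ X] [FiniteDimensional ℝ E]
    {f : ℝ → E → E} {f' : ℝ → E → E →L[ℝ] E} {T : ℝ} (hT : 0 ≤ T)
    (hf : ∀ t ∈ Icc 0 T, ∀ y, HasFDerivAt (f t) (f' t y) y)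
    (hf' : ContinuousOn (fun p : ℝ × E => f' p.1 p.2) (Icc 0 T ×ˢ univ)) {γ : X → ℝ → E}
    (hγ : ∀ x, IsIntegralCurveOn (γ x) f (Icc 0 T))
    (hγc : ContinuousOn (fun p : ℝ × X => γ p.2 p.1) (Icc 0 T ×ˢ univ))
    (hL : ∀ x₀, ∃ L : ℝ, ∀ x, ∀ t ∈ Icc 0 T, ‖γ x t - γ x₀ t‖ ≤ L * ‖x - x₀‖)
    {J₀ : X →L[ℝ] E} (h0 : ∀ x, HasFDerivAt (fun x => γ x 0) J₀ x) :
    ∃ J : X → ℝ → X →L[ℝ] E, (∀ x, J x 0 = J₀) ∧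
      (∀ x, ∀ t ∈ Icc 0 T, HasDerivWithinAt (J x) (f' t (γ x t) ∘L J x t) (Icc 0 T) t) ∧
      ContinuousOn (fun p : ℝ × X => J p.2 p.1) (Icc 0 T ×ˢ univ) ∧
      ∀ t ∈ Icc 0 T, ∀ x, HasFDerivAt (fun x => γ x t) (J x t) x := by
  -- The linearized equation is read as a linear equation in the space of operators `X →L[ℝ] E`,
  -- with composition on the left as coefficient.
  let A : ℝ → X → (X →L[ℝ] E) →L[ℝ] (X →L[ℝ] E) := fun t x =>
    ContinuousLinearMap.compL ℝ X E E (f' t (γ x t))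
  have hA : ContinuousOn (fun p : ℝ × X => A p.1 p.2) (Icc 0 T ×ˢ univ) :=
    (ContinuousLinearMap.compL ℝ X E E).continuous.comp_continuousOn
      (hf'.comp (continuousOn_fst.prodMk hγc) fun p hp => ⟨hp.1, trivial⟩)
  have hAx : ∀ x, ContinuousOn (fun t => A t x) (Icc 0 T) := fun x =>
    hA.comp (f := fun t => (t, x)) (by fun_prop) fun t ht => ⟨ht, trivial⟩
  choose J hJ0 hJ using fun x => exists_integralCurve_linear hT (hAx x) J₀
  refine ⟨J, hJ0, hJ, continuousOn_integralCurve_linear hT hA hJ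
    (by simpa [hJ0] using continuous_const), fun t ht x => ?_⟩
  obtain ⟨L, hL⟩ := hL x
  exact hasFDerivAt_integralCurve hf hf' hγ (Eventually.of_forall hL) (hJ x)
    (by rw [hJ0]; exact h0 x) ht

end ODE

/-! ### Regularity of the flow -/

section Flow

open scoped NNReal

variable {d : ℕ} {T : ℝ} {w : ℝ → Vec d → Vec d}

/-- Time-dependent vector fields on `[0,T] × ℝ^d` that are bounded and continuous together with
their first two spatial derivatives. -/
structure IsC2Field (T : ℝ) (w : ℝ → Vec d → Vec d) : Prop where
  contDiff : ∀ t ∈ Icc 0 T, ContDiff ℝ 2 (w t)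
  continuousOn : ContinuousOn (fun p : ℝ × Vec d => w p.1 p.2) (Icc 0 T ×ˢ univ)
  continuousOn_fderiv :
    ContinuousOn (fun p : ℝ × Vec d => fderiv ℝ (w p.1) p.2) (Icc 0 T ×ˢ univ)
  continuousOn_fderiv_fderiv :
    ContinuousOn (fun p : ℝ × Vec d => fderiv ℝ (fderiv ℝ (w p.1)) p.2) (Icc 0 T ×ˢ univ)
  bounded : ∃ M : ℝ≥0, ∀ t ∈ Icc 0 T, ∀ x, ‖w t x‖ ≤ M ∧ ‖fderiv ℝ (w t) x‖ ≤ M ∧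
    ‖fderiv ℝ (fderiv ℝ (w t)) x‖ ≤ M

namespace IsC2Field

theorem hasFDerivAt (hw : IsC2Field T w) {t : ℝ} (ht : t ∈ Icc 0 T) (x : Vec d) :
    HasFDerivAt (w t) (fderiv ℝ (w t) x) x :=
  ((hw.contDiff t ht).differentiable (by norm_num) x).hasFDerivAt

theorem contDiff_fderiv (hw : IsC2Field T w) {t : ℝ} (ht : t ∈ Icc 0 T) :
    ContDiff ℝ 1 (fderiv ℝ (w t)) :=
  (hw.contDiff t ht).fderiv_right (by norm_num)

theorem exists_lipschitzWith (hw : IsC2Field T w) :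
    ∃ M : ℝ≥0, ∀ t ∈ Icc 0 T, LipschitzWith M (w t) ∧ LipschitzWith M (fderiv ℝ (w t)) ∧
      ∀ x, ‖w t x‖ ≤ M ∧ ‖fderiv ℝ (w t) x‖ ≤ M := by
  obtain ⟨M, hM⟩ := hw.bounded
  refine ⟨M, fun t ht => ⟨lipschitzWith_of_nnnorm_fderiv_le (𝕜 := ℝ)
    ((hw.contDiff t ht).differentiable (by norm_num)) fun x => (hM t ht x).2.1,
    lipschitzWith_of_nnnorm_fderiv_le (𝕜 := ℝ)
    ((hw.contDiff_fderiv ht).differentiable (by norm_num)) fun x => (hM t ht x).2.2,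
    fun x => ⟨(hM t ht x).1, (hM t ht x).2.1⟩⟩⟩

theorem exists_integralCurve (hw : IsC2Field T w) {t₀ : ℝ} (ht₀ : t₀ ∈ Icc 0 T) (x : Vec d) :
    ∃ γ : ℝ → Vec d, γ t₀ = x ∧ IsIntegralCurveOn γ w (Icc 0 T) := by
  obtain ⟨M, hM⟩ := hw.exists_lipschitzWith
  exact exists_integralCurve_of_lipschitz_of_bounded (fun t ht => (hM t ht).1)
    (fun x => hw.continuousOn.comp (f := fun t => (t, x)) (by fun_prop) fun t ht => ⟨ht, trivial⟩)
    (fun t ht x => ((hM t ht).2.2 x).1) ht₀ x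

theorem eqOn_integralCurve (hw : IsC2Field T w) {t₀ : ℝ} (ht₀ : t₀ ∈ Icc 0 T) {γ η : ℝ → Vec d}
    (hγ : IsIntegralCurveOn γ w (Icc 0 T)) (hη : IsIntegralCurveOn η w (Icc 0 T))
    (h : γ t₀ = η t₀) : EqOn γ η (Icc 0 T) := by
  obtain ⟨M, hM⟩ := hw.exists_lipschitzWith
  exact IsIntegralCurveOn.eqOn_of_lipschitz (fun t ht => (hM t ht).1) hγ hη ht₀ h

end IsC2Field

theorem flow_zero (T : ℝ) (w : ℝ → Vec d → Vec d) : flow T w 0 = id := by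
  funext x
  unfold flow
  split_ifs with h
  · exact h.choose_spec.1
  · rfl

/-- The space of values of a vector field together with its first derivative. -/
abbrev JetSpace (d : ℕ) : Type := Vec d × (Vec d →L[ℝ] Vec d)

theorem continuousOn_clm_prod {X E F G : Type*} [TopologicalSpace X] [NormedAddCommGroup E]
    [NormedSpace ℝ E] [NormedAddCommGroup F] [NormedSpace ℝ F] [NormedAddCommGroup G]
    [NormedSpace ℝ G] {f : X → E →L[ℝ] F} {g : X → E →L[ℝ] G} {s : Set X} (hf : ContinuousOn f s)
    (hg : ContinuousOn g s) : ContinuousOn (fun x => (f x).prod (g x)) s :=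
  (ContinuousLinearMap.prodₗᵢ (𝕜 := ℝ) (E := E) (F := F) (G := G) ℝ).continuous.comp_continuousOn
    (hf.prodMk hg)

namespace IsC2Field

theorem integralCurve_flow (hT : 0 ≤ T) (hw : IsC2Field T w) (x : Vec d) :
    IsIntegralCurveOn (fun t => flow T w t x) w (Icc 0 T) := by
  have h : ∃ γ, IsTrajectory T w x γ := hw.exists_integralCurve ⟨le_rfl, hT⟩ x
  have e : (fun t => flow T w t x) = h.choose := by
    funext t
    rw [flow, dif_pos h]
  rw [e]
  exact h.choose_spec.2

/-- Both halves pose the Cauchy problem at time `t` instead of `0`: its uniqueness gives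
injectivity, and solving it backwards from `y` yields a preimage. -/
theorem bijective_flow (hT : 0 ≤ T) (hw : IsC2Field T w) {t : ℝ} (ht : t ∈ Icc 0 T) :
    Function.Bijective (flow T w t) := by
  have h0 : (0 : ℝ) ∈ Icc 0 T := ⟨le_rfl, hT⟩
  constructor
  · intro x y hxy
    have := hw.eqOn_integralCurve ht (hw.integralCurve_flow hT x) (hw.integralCurve_flow hT y) hxy
      h0
    simpa [flow_zero] using this
  · intro y
    obtain ⟨γ, hγt, hγ⟩ := hw.exists_integralCurve ht y
    refine ⟨γ 0, ?_⟩
    rw [← hγt]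
    exact hw.eqOn_integralCurve h0 (hw.integralCurve_flow hT (γ 0)) hγ (by simp [flow_zero]) ht

theorem exists_lipschitz_flow (hT : 0 ≤ T) (hw : IsC2Field T w) :
    ∃ L : ℝ≥0, ∀ t ∈ Icc 0 T, LipschitzWith L (flow T w t) := by
  obtain ⟨M, hM⟩ := hw.exists_lipschitzWith
  refine ⟨⟨Real.exp (M * T), (Real.exp_pos _).le⟩, fun t ht => LipschitzWith.of_dist_le_mul
    fun x y => ?_⟩
  have := dist_le_of_trajectories_ODE_of_mem (s := fun _ => univ) (K := M) (a := 0) (b := T)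
    (fun t ht => (hM t (Ico_subset_Icc_self ht)).1.lipschitzOnWith)
    (fun t ht => (hw.integralCurve_flow hT x t ht).continuousWithinAt)
    (fun t ht => hasDerivWithinAt_Ici_of_Icc
      (hw.integralCurve_flow hT x t (Ico_subset_Icc_self ht)) ht) (fun _ _ => trivial)
    (fun t ht => (hw.integralCurve_flow hT y t ht).continuousWithinAt)
    (fun t ht => hasDerivWithinAt_Ici_of_Icc
      (hw.integralCurve_flow hT y t (Ico_subset_Icc_self ht)) ht) (fun _ _ => trivial)
    (δ := dist x y) (by simp [flow_zero]) t ht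
  refine this.trans ?_
  rw [mul_comm, sub_zero]
  refine mul_le_mul_of_nonneg_right (Real.exp_le_exp.2 ?_) dist_nonneg
  exact mul_le_mul_of_nonneg_left ht.2 M.2

theorem continuousOn_flow (hT : 0 ≤ T) (hw : IsC2Field T w) :
    ContinuousOn (fun p : ℝ × Vec d => flow T w p.1 p.2) (Icc 0 T ×ˢ univ) := by
  obtain ⟨L, hL⟩ := hw.exists_lipschitz_flow hT
  exact continuousOn_prod_of_continuousOn_lipschitzOnWith' _ L
    (fun t ht => (hL t ht).lipschitzOnWith)
    (fun x _ t ht => (hw.integralCurve_flow hT x t ht).continuousWithinAt)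

/-- The flow is differentiable, and its derivative solves the linearized equation. -/
theorem exists_hasFDerivAt_flow (hT : 0 ≤ T) (hw : IsC2Field T w) :
    ∃ Y : Vec d → ℝ → Vec d →L[ℝ] Vec d, (∀ x, Y x 0 = ContinuousLinearMap.id ℝ _) ∧
      (∀ x, ∀ t ∈ Icc 0 T, HasDerivWithinAt (Y x)
        (fderiv ℝ (w t) (flow T w t x) ∘L Y x t) (Icc 0 T) t) ∧
      ContinuousOn (fun p : ℝ × Vec d => Y p.2 p.1) (Icc 0 T ×ˢ univ) ∧
      ∀ t ∈ Icc 0 T, ∀ x, HasFDerivAt (flow T w t) (Y x t) x := by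
  obtain ⟨L, hL⟩ := hw.exists_lipschitz_flow hT
  exact exists_hasFDerivAt_integralCurve (X := Vec d) (f := w) (f' := fun t => fderiv ℝ (w t))
    (γ := fun x t => flow T w t x) hT
    (fun t ht y => hw.hasFDerivAt ht y) hw.continuousOn_fderiv (hw.integralCurve_flow hT)
    (hw.continuousOn_flow hT) (fun y => ⟨L, fun x s hs => (hL s hs).norm_sub_le x y⟩)
    (fun x => by simpa only [flow_zero] using hasFDerivAt_id x)

theorem differentiable_flow (hT : 0 ≤ T) (hw : IsC2Field T w) {t : ℝ} (ht : t ∈ Icc 0 T) :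
    Differentiable ℝ (flow T w t) := by
  obtain ⟨Y, -, -, -, h⟩ := hw.exists_hasFDerivAt_flow hT
  exact fun x => (h t ht x).differentiableAt

theorem hasDerivWithinAt_fderiv_flow (hT : 0 ≤ T) (hw : IsC2Field T w) (x : Vec d) {t : ℝ}
    (ht : t ∈ Icc 0 T) : HasDerivWithinAt (fun t => fderiv ℝ (flow T w t) x)
      (fderiv ℝ (w t) (flow T w t x) ∘L fderiv ℝ (flow T w t) x) (Icc 0 T) t := by
  obtain ⟨Y, -, h1, -, h⟩ := hw.exists_hasFDerivAt_flow hT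
  have := h1 x t ht
  rw [← (h t ht x).fderiv] at this
  exact this.congr_of_mem (fun s hs => (h s hs x).fderiv) ht

theorem continuousOn_fderiv_flow (hT : 0 ≤ T) (hw : IsC2Field T w) :
    ContinuousOn (fun p : ℝ × Vec d => fderiv ℝ (flow T w p.1) p.2) (Icc 0 T ×ˢ univ) := by
  obtain ⟨Y, -, -, h1, h⟩ := hw.exists_hasFDerivAt_flow hT
  exact h1.congr fun p hp => (h p.1 hp.1 p.2).fderiv

/-- The field that drives `(Φ, DΦ)` is not globally Lipschitz, as its derivative grows with the
second component. Lipschitz dependence of `DΦ` is therefore taken directly from Grönwall: the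
inhomogeneity `(A - A₀) Y₀` is bounded by the Lipschitz constant `M` of `Dw`, that of `Φ`, and `‖Y₀‖
≤ L`. -/
theorem exists_norm_fderiv_flow_sub_le (hT : 0 ≤ T) (hw : IsC2Field T w) (x₀ : Vec d) :
    ∃ L, ∀ x, ∀ t ∈ Icc 0 T,
      ‖fderiv ℝ (flow T w t) x - fderiv ℝ (flow T w t) x₀‖ ≤ L * ‖x - x₀‖ := by
  obtain ⟨M, hM⟩ := hw.exists_lipschitzWith
  obtain ⟨L, hL⟩ := hw.exists_lipschitz_flow hT
  refine ⟨2 * (M * L * L) * Real.exp ((M + 1) * T), fun x => ?_⟩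
  have key := norm_le_two_mul_exp_of_deriv_le
    (e := fun t => fderiv ℝ (flow T w t) x - fderiv ℝ (flow T w t) x₀)
    (K := M + 1) (δ := M * L * L * ‖x - x₀‖) (by simp) (by positivity)
    (fun t ht => (hw.hasDerivWithinAt_fderiv_flow hT x ht).sub
      (hw.hasDerivWithinAt_fderiv_flow hT x₀ ht)) (by simp [flow_zero]; positivity)
    (fun t ht => ?_)
  · intro t ht
    refine (key t ht).trans_eq ?_
    ring
  · set A := fderiv ℝ (w t) (flow T w t x)
    set A₀ := fderiv ℝ (w t) (flow T w t x₀)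
    set Y := fderiv ℝ (flow T w t) x
    set Y₀ := fderiv ℝ (flow T w t) x₀
    have e1 : A ∘L Y - A₀ ∘L Y₀ = A ∘L (Y - Y₀) + (A - A₀) ∘L Y₀ := by
      simp
    have e2 : ‖A‖ ≤ M + 1 := (((hM t ht).2.2 _).2).trans (by simp)
    have e3 : ‖A - A₀‖ ≤ M * (L * ‖x - x₀‖) := by
      refine ((hM t ht).2.1.norm_sub_le _ _).trans ?_
      gcongr
      exact (hL t ht).norm_sub_le _ _
    have e4 : ‖Y₀‖ ≤ L := norm_fderiv_le_of_lipschitz ℝ (hL t ht)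
    rw [e1]
    refine (norm_add_le _ _).trans (add_le_add ?_ ?_)
    · exact (ContinuousLinearMap.opNorm_comp_le _ _).trans (by gcongr)
    · refine (ContinuousLinearMap.opNorm_comp_le _ _).trans ?_
      calc ‖A - A₀‖ * ‖Y₀‖ ≤ M * (L * ‖x - x₀‖) * L := by gcongr
        _ = _ := by ring

/-- The derivative of the flow is differentiable in space, with jointly continuous derivative. -/
theorem exists_hasFDerivAt_fderiv_flow (hT : 0 ≤ T) (hw : IsC2Field T w) :
    ∃ Z : Vec d → ℝ → Vec d →L[ℝ] Vec d →L[ℝ] Vec d,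
      ContinuousOn (fun p : ℝ × Vec d => Z p.2 p.1) (Icc 0 T ×ˢ univ) ∧
      ∀ t ∈ Icc 0 T, ∀ x, HasFDerivAt (fderiv ℝ (flow T w t)) (Z x t) x := by
  -- The jet `(Φ, DΦ)` solves an equation whose field `f` is `C¹` in space because `w` is `C²`, so
  -- the theorem on differentiability in the initial value applies a second time.
  let γ : Vec d → ℝ → (JetSpace d) := fun x t => (flow T w t x, fderiv ℝ (flow T w t) x)
  let f : ℝ → JetSpace d → (JetSpace d) := fun t p => (w t p.1, fderiv ℝ (w t) p.1 ∘L p.2)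
  let f' : ℝ → JetSpace d → JetSpace d →L[ℝ] JetSpace d := fun t p =>
    (fderiv ℝ (w t) p.1 ∘L ContinuousLinearMap.fst ℝ (Vec d) (Vec d →L[ℝ] Vec d)).prod
      (ContinuousLinearMap.compL ℝ (Vec d) (Vec d) (Vec d) (fderiv ℝ (w t) p.1) ∘L
          ContinuousLinearMap.snd ℝ (Vec d) (Vec d →L[ℝ] Vec d) +
        (ContinuousLinearMap.compL ℝ (Vec d) (Vec d) (Vec d)).flip p.2 ∘L
          (fderiv ℝ (fderiv ℝ (w t)) p.1 ∘L ContinuousLinearMap.fst ℝ (Vec d) (Vec d →L[ℝ] Vec d)))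
  have hf : ∀ t ∈ Icc 0 T, ∀ p, HasFDerivAt (f t) (f' t p) p := by
    intro t ht p
    have h1 : HasFDerivAt (fun p : JetSpace d => w t p.1)
        (fderiv ℝ (w t) p.1 ∘L ContinuousLinearMap.fst ℝ (Vec d) (Vec d →L[ℝ] Vec d)) p :=
      (hw.hasFDerivAt ht p.1).comp p hasFDerivAt_fst
    have h2 : HasFDerivAt (fun p : JetSpace d => fderiv ℝ (w t) p.1)
        (fderiv ℝ (fderiv ℝ (w t)) p.1 ∘L ContinuousLinearMap.fst ℝ (Vec d) (Vec d →L[ℝ] Vec d)) p :=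
      (((hw.contDiff_fderiv ht).differentiable (by norm_num) p.1).hasFDerivAt).comp p
        hasFDerivAt_fst
    exact h1.prodMk (h2.clm_comp hasFDerivAt_snd)
  have hf' : ContinuousOn (fun p : ℝ × JetSpace d => f' p.1 p.2) (Icc 0 T ×ˢ univ) := by
    have h1 : ContinuousOn (fun p : ℝ × JetSpace d => fderiv ℝ (w p.1) p.2.1) (Icc 0 T ×ˢ univ) :=
      hw.continuousOn_fderiv.comp (f := fun p : ℝ × JetSpace d => (p.1, p.2.1)) (by fun_prop)
        fun p hp => ⟨hp.1, trivial⟩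
    have h2 : ContinuousOn (fun p : ℝ × JetSpace d => fderiv ℝ (fderiv ℝ (w p.1)) p.2.1)
        (Icc 0 T ×ˢ univ) :=
      hw.continuousOn_fderiv_fderiv.comp (f := fun p : ℝ × JetSpace d => (p.1, p.2.1)) (by fun_prop)
        fun p hp => ⟨hp.1, trivial⟩
    have h3 : ContinuousOn (fun p : ℝ × JetSpace d => (ContinuousLinearMap.compL ℝ (Vec d) (Vec d) (Vec d)).flip p.2.2)
        (Icc 0 T ×ˢ univ) := by fun_prop
    have h4 : ContinuousOn (fun p : ℝ × JetSpace d =>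
        ContinuousLinearMap.compL ℝ (Vec d) (Vec d) (Vec d) (fderiv ℝ (w p.1) p.2.1)) (Icc 0 T ×ˢ univ) :=
      (ContinuousLinearMap.compL ℝ (Vec d) (Vec d) (Vec d)).continuous.comp_continuousOn h1
    have h5 := h1.clm_comp (continuousOn_const (c := ContinuousLinearMap.fst ℝ (Vec d)
      (Vec d →L[ℝ] Vec d)))
    have h6 := h2.clm_comp (continuousOn_const (c := ContinuousLinearMap.fst ℝ (Vec d)
      (Vec d →L[ℝ] Vec d)))
    have h7 := h4.clm_comp (continuousOn_const (c := ContinuousLinearMap.snd ℝ (Vec d)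
      (Vec d →L[ℝ] Vec d)))
    exact continuousOn_clm_prod h5 (h7.add (h3.clm_comp h6))
  have hγ : ∀ x, IsIntegralCurveOn (γ x) f (Icc 0 T) := fun x t ht =>
    (hw.integralCurve_flow hT x t ht).prodMk (hw.hasDerivWithinAt_fderiv_flow hT x ht)
  have hγc : ContinuousOn (fun p : ℝ × Vec d => γ p.2 p.1) (Icc 0 T ×ˢ univ) :=
    (hw.continuousOn_flow hT).prodMk (hw.continuousOn_fderiv_flow hT)
  obtain ⟨L, hL⟩ := hw.exists_lipschitz_flow hT
  have hLip : ∀ x₀, ∃ L : ℝ, ∀ x, ∀ t ∈ Icc 0 T, ‖γ x t - γ x₀ t‖ ≤ L * ‖x - x₀‖ := by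
    intro x₀
    obtain ⟨L', hL'⟩ := hw.exists_norm_fderiv_flow_sub_le hT x₀
    refine ⟨max L L', fun y s hs => ?_⟩
    rw [max_mul_of_nonneg _ _ (norm_nonneg _)]
    exact max_le_max ((hL s hs).norm_sub_le y x₀) (hL' y s hs)
  have h0 : ∀ x, HasFDerivAt (fun x => γ x 0) ((ContinuousLinearMap.id ℝ (Vec d)).prod 0) x := by
    intro x
    have : (fun x => γ x 0) = fun x => (x, ContinuousLinearMap.id ℝ (Vec d)) := by
      funext x
      simp only [γ, flow_zero, id_eq, fderiv_id]
    rw [this]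
    exact (hasFDerivAt_id x).prodMk (hasFDerivAt_const _ x)
  obtain ⟨J, -, -, hJc, hJ⟩ := exists_hasFDerivAt_integralCurve hT hf hf' hγ hγc hLip h0
  exact ⟨fun x t => ContinuousLinearMap.snd ℝ (Vec d) (Vec d →L[ℝ] Vec d) ∘L J x t,
    continuousOn_const.clm_comp hJc, fun t ht x => (hJ t ht x).snd⟩

theorem continuousOn_fderiv_fderiv_flow (hT : 0 ≤ T) (hw : IsC2Field T w) :
    ContinuousOn (fun p : ℝ × Vec d => fderiv ℝ (fderiv ℝ (flow T w p.1)) p.2)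
      (Icc 0 T ×ˢ univ) := by
  obtain ⟨Z, h1, h⟩ := hw.exists_hasFDerivAt_fderiv_flow hT
  exact h1.congr fun p hp => (h p.1 hp.1 p.2).fderiv

theorem contDiff_flow (hT : 0 ≤ T) (hw : IsC2Field T w) {t : ℝ} (ht : t ∈ Icc 0 T) :
    ContDiff ℝ 2 (flow T w t) := by
  obtain ⟨Z, -, h⟩ := hw.exists_hasFDerivAt_fderiv_flow hT
  have h1 : ContDiff ℝ 1 (fderiv ℝ (flow T w t)) := by
    refine contDiff_one_iff_fderiv.2 ⟨fun x => (h t ht x).differentiableAt, ?_⟩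
    rw [← continuousOn_univ]
    exact (hw.continuousOn_fderiv_fderiv_flow hT).comp (f := fun x => (t, x)) (by fun_prop)
      fun x _ => ⟨ht, trivial⟩
  exact (contDiff_succ_iff_fderiv (n := 1)).2
    ⟨hw.differentiable_flow hT ht, by simp, h1⟩

end IsC2Field

end Flow

/-! ### Determinants and traces -/

section Det

variable {d : ℕ}

/-- The trace of a continuous linear endomorphism of `ℝ^d`. -/
noncomputable def clmTrace : (Vec d →L[ℝ] Vec d) →ₗ[ℝ] ℝ :=
  LinearMap.trace ℝ (Vec d) ∘ₗ ContinuousLinearMap.coeLM ℝ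

theorem clmTrace_apply (A : Vec d →L[ℝ] Vec d) :
    clmTrace A = ∑ i, A (EuclideanSpace.single i 1) i := by
  rw [clmTrace, LinearMap.comp_apply,
    LinearMap.trace_eq_matrix_trace ℝ (EuclideanSpace.basisFun (Fin d) ℝ).toBasis]
  simp [Matrix.trace, LinearMap.toMatrix_apply]

theorem clmTrace_mul_comm (A B : Vec d →L[ℝ] Vec d) : clmTrace (A ∘L B) = clmTrace (B ∘L A) :=
  LinearMap.trace_mul_comm ℝ (A : Vec d →ₗ[ℝ] Vec d) (B : Vec d →ₗ[ℝ] Vec d)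

theorem tr_jac (u : Vec d → Vec d) (x : Vec d) : tr (jac u x) = clmTrace (fderiv ℝ u x) := by
  rw [clmTrace_apply]
  rfl

theorem clm_det_eq (A : Vec d →L[ℝ] Vec d) :
    A.det = ∑ σ : Equiv.Perm (Fin d), Equiv.Perm.sign σ •
      ∏ i, A (EuclideanSpace.single i 1) (σ i) := by
  rw [ContinuousLinearMap.det, ← LinearMap.det_toMatrix (EuclideanSpace.basisFun (Fin d) ℝ).toBasis,
    Matrix.det_apply]
  simp [LinearMap.toMatrix_apply]

theorem differentiable_clm_det : Differentiable ℝ fun A : Vec d →L[ℝ] Vec d => A.det := by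
  simp_rw [clm_det_eq, Units.smul_def, zsmul_eq_mul]
  fun_prop

/-- The determinant of `1 + s M` is a polynomial `1 + tr(M) s + P(s) s²`. -/
theorem hasDerivAt_det_id_add_smul (B : Vec d →L[ℝ] Vec d) :
    HasDerivAt (fun s : ℝ => (ContinuousLinearMap.id ℝ (Vec d) + s • B).det) (clmTrace B) 0 := by
  set b := (EuclideanSpace.basisFun (Fin d) ℝ).toBasis
  set M := LinearMap.toMatrix b b (B : Vec d →ₗ[ℝ] Vec d) with hM
  have h1 : ∀ s : ℝ, (ContinuousLinearMap.id ℝ (Vec d) + s • B).det = (1 + s • M).det := by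
    intro s
    rw [ContinuousLinearMap.det, ← LinearMap.det_toMatrix b]
    congr 1
    simp [hM]
  have h2 : clmTrace B = M.trace := by
    rw [clmTrace, LinearMap.comp_apply, LinearMap.trace_eq_matrix_trace ℝ b]
    rfl
  rw [h2, funext h1, funext fun s => Matrix.det_one_add_smul s M]
  set P := (Matrix.det (1 + (Polynomial.X : Polynomial ℝ) • M.map Polynomial.C)).divX.divX
  have h3 : HasDerivAt (fun s : ℝ => 1 + M.trace * s + P.eval s * s ^ 2)
      (0 + M.trace * 1 + (P.derivative.eval 0 * 0 ^ 2 + P.eval 0 * (2 * 0 ^ 1 * 1))) 0 :=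
    ((hasDerivAt_const _ _).add ((hasDerivAt_id _).const_mul _)).add
      ((P.hasDerivAt 0).mul ((hasDerivAt_id _).pow 2))
  simpa using h3

/-- Jacobi's formula in the direction `B A`, where `det (A + s B A) = det (1 + s B) det A` makes
invertibility of `A` unnecessary. This is the direction in which `DΦ_t` moves in time, with `B =
Dw`. -/
theorem fderiv_det_comp (A B : Vec d →L[ℝ] Vec d) :
    fderiv ℝ (fun A : Vec d →L[ℝ] Vec d => A.det) A (B ∘L A) = clmTrace B * A.det := by
  have h1 : HasDerivAt (fun s : ℝ => A + s • (B ∘L A)) (B ∘L A) 0 := by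
    simpa using ((hasDerivAt_id (0 : ℝ)).smul_const (B ∘L A)).const_add A
  have h2 := HasFDerivAt.comp_hasDerivAt_of_eq (0 : ℝ)
    (differentiable_clm_det A).hasFDerivAt h1
    (by ext; simp)
  have h3 : ∀ s : ℝ, (A + s • (B ∘L A)).det
      = (ContinuousLinearMap.id ℝ (Vec d) + s • B).det * A.det := fun s => by
    have : A + s • (B ∘L A) = (ContinuousLinearMap.id ℝ (Vec d) + s • B) ∘L A := by
      ext; simp
    rw [this]
    exact LinearMap.det_comp _ _
  have h4 := (hasDerivAt_det_id_add_smul B).mul_const A.det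
  refine h2.unique (h4.congr_of_eventuallyEq (Eventually.of_forall h3))

end Det

/-! ### Velocity fields of class `C¹([0,T]; C^k_c)` -/

section Velocity

open scoped NNReal

variable {d : ℕ} {T : ℝ} {k : ℕ} {D : Set (Vec d)} {w : ℝ → Vec d → Vec d}

theorem continuousOn_uncurry_of_uniform {Z X G : Type*} [TopologicalSpace Z] [TopologicalSpace X]
    [PseudoMetricSpace G] {g : Z → X → G} {S : Set Z} (hg : ∀ t ∈ S, Continuous (g t))
    (hu : ∀ t ∈ S, ∀ ε > 0, ∀ᶠ s in 𝓝[S] t, ∀ x, dist (g s x) (g t x) ≤ ε) :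
    ContinuousOn (fun p : Z × X => g p.1 p.2) (S ×ˢ univ) := by
  rintro ⟨t, x⟩ ⟨ht, -⟩
  refine Metric.tendsto_nhds.2 fun ε hε => ?_
  have h1 : Tendsto Prod.fst (𝓝[S ×ˢ (univ : Set X)] (t, x)) (𝓝[S] t) :=
    tendsto_nhdsWithin_of_tendsto_nhds_of_eventually_within _
      ((continuous_fst.tendsto _).mono_left nhdsWithin_le_nhds)
      (eventually_mem_nhdsWithin.mono fun p hp => hp.1)
  have h2 : Tendsto Prod.snd (𝓝[S ×ˢ (univ : Set X)] (t, x)) (𝓝 x) :=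
    (continuous_snd.tendsto _).mono_left nhdsWithin_le_nhds
  filter_upwards [h1.eventually (hu t ht (ε / 2) (by positivity)),
    h2.eventually (Metric.tendsto_nhds.1 ((hg t ht).tendsto x) (ε / 2) (by positivity))] with p h h'
  have := dist_triangle (g p.1 p.2) (g t p.2) (g t x)
  have := h p.2
  change dist (g p.1 p.2) (g t x) < ε
  linarith

/-- Near `t` the difference quotients are within `1` of `w'`, whose derivatives are bounded by some
`C`; increments are thus at most `(C + 1) |s - t|`, which explains the radius `ε / (C + 1)`. -/
theorem IsC1Ckc.eventually_norm_iteratedFDeriv_sub_le (hw : IsC1Ckc T k D w) {j : ℕ} (hj : j ≤ k)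
    {t : ℝ} (ht : t ∈ Icc 0 T) {ε : ℝ} (hε : 0 < ε) :
    ∀ᶠ s in 𝓝[Icc 0 T] t, ∀ x, ‖iteratedFDeriv ℝ j (fun x => w s x - w t x) x‖ ≤ ε := by
  obtain ⟨hwt, w', hw', h⟩ := hw
  have hjk : (j : WithTop ℕ∞) ≤ k := by exact_mod_cast hj
  obtain ⟨C, hC⟩ := ((hw' t ht).compact.iteratedFDeriv (𝕜 := ℝ) j).exists_bound_of_continuous
    ((hw' t ht).contDiff.continuous_iteratedFDeriv hjk)
  have hC0 : 0 ≤ C := (norm_nonneg _).trans (hC 0)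
  have h1 := Metric.tendstoUniformly_iff.1 (h t ht j hj).1 1 one_pos
  rw [eventually_nhdsWithin_iff] at h1 ⊢
  filter_upwards [h1, Metric.ball_mem_nhds t (show 0 < ε / (C + 1) by positivity)]
    with s hs hsb hsI x
  rcases eq_or_ne s t with rfl | hne
  · have : (fun x => w s x - w s x) = fun _ => 0 := by funext; simp
    rw [this, iteratedFDeriv_fun_zero]
    simpa using hε.le
  · have hst : s - t ≠ 0 := sub_ne_zero.2 hne
    have hx := hs ⟨hsI, hne⟩ x
    have hcd : ContDiffAt ℝ j (fun x => w s x - w t x) x :=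
      (((hwt s hsI).contDiff.of_le hjk).sub ((hwt t ht).contDiff.of_le hjk)).contDiffAt
    have e : iteratedFDeriv ℝ j (fun x => (s - t)⁻¹ • (w s x - w t x)) x
        = (s - t)⁻¹ • iteratedFDeriv ℝ j (fun x => w s x - w t x) x :=
      iteratedFDeriv_const_smul_apply' hcd
    rw [e, dist_eq_norm'] at hx
    have h2 : ‖(s - t)⁻¹ • iteratedFDeriv ℝ j (fun x => w s x - w t x) x‖ ≤ C + 1 := by
      have := norm_le_norm_add_norm_sub' ((s - t)⁻¹ • iteratedFDeriv ℝ j (fun x => w s x - w t x) x)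
        (iteratedFDeriv ℝ j (w' t) x)
      linarith [hC x]
    rw [norm_smul, norm_inv, inv_mul_le_iff₀ (norm_pos_iff.2 hst)] at h2
    refine h2.trans ?_
    rw [Metric.mem_ball, dist_eq_norm, lt_div_iff₀ (by positivity)] at hsb
    exact hsb.le

/-- Continuity bounds `g` on the compact set `[0,T] × closure D`, and outside `D` it vanishes. -/
theorem exists_bound_of_tsupport_subset {G : Type*} [NormedAddCommGroup G]
    {g : ℝ → Vec d → G} (hD : Bornology.IsBounded D)
    (hg : ContinuousOn (fun p : ℝ × Vec d => g p.1 p.2) (Icc 0 T ×ˢ univ))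
    (hs : ∀ t ∈ Icc 0 T, tsupport (g t) ⊆ D) : ∃ M, ∀ t ∈ Icc 0 T, ∀ x, ‖g t x‖ ≤ M := by
  obtain ⟨M, hM⟩ := (isCompact_Icc.prod hD.isCompact_closure).exists_bound_of_continuousOn
    (hg.mono (prod_mono_right (subset_univ _)) :
      ContinuousOn (fun p : ℝ × Vec d => g p.1 p.2) (Icc 0 T ×ˢ closure D))
  refine ⟨max M 0, fun t ht x => ?_⟩
  by_cases hx : x ∈ D
  · exact (hM (t, x) ⟨ht, subset_closure hx⟩).trans (le_max_left _ _)
  · rw [image_eq_zero_of_notMem_tsupport fun h => hx (hs t ht h), norm_zero]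
    exact le_max_right _ _

theorem continuousOn_uncurry_fderiv_of_uniform {G : Type*} [NormedAddCommGroup G]
    [NormedSpace ℝ G] {g : ℝ → Vec d → G} {S : Set ℝ} (hg : ∀ t ∈ S, ContDiff ℝ 1 (g t))
    (hu : ∀ t ∈ S, ∀ ε > 0, ∀ᶠ s in 𝓝[S] t, ∀ x, ‖fderiv ℝ (fun x => g s x - g t x) x‖ ≤ ε) :
    ContinuousOn (fun p : ℝ × Vec d => fderiv ℝ (g p.1) p.2) (S ×ˢ univ) := by
  refine continuousOn_uncurry_of_uniform (fun t ht => (hg t ht).continuous_fderiv one_ne_zero)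
    fun t ht ε hε => ?_
  filter_upwards [hu t ht ε hε, self_mem_nhdsWithin] with s hs hsS x
  rw [dist_eq_norm, ← fderiv_fun_sub ((hg s hsS).differentiable one_ne_zero x)
    ((hg t ht).differentiable one_ne_zero x)]
  exact hs x

theorem IsC1Ckc.contDiff_two (hw : IsC1Ckc T k D w) (hk : 2 ≤ k) {t : ℝ} (ht : t ∈ Icc 0 T) :
    ContDiff ℝ 2 (w t) :=
  (hw.1 t ht).contDiff.of_le (by exact_mod_cast hk)

theorem IsC1Ckc.continuousOn (hw : IsC1Ckc T k D w) :
    ContinuousOn (fun p : ℝ × Vec d => w p.1 p.2) (Icc 0 T ×ˢ univ) := by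
  refine continuousOn_uncurry_of_uniform (fun t ht => (hw.1 t ht).contDiff.continuous)
    fun t ht ε hε => ?_
  filter_upwards [hw.eventually_norm_iteratedFDeriv_sub_le (j := 0) (by lia) ht hε] with s hs x
  have := hs x
  rwa [norm_iteratedFDeriv_zero, ← dist_eq_norm] at this

theorem IsC1Ckc.continuousOn_fderiv (hw : IsC1Ckc T k D w) (hk : 2 ≤ k) :
    ContinuousOn (fun p : ℝ × Vec d => fderiv ℝ (w p.1) p.2) (Icc 0 T ×ˢ univ) := by
  refine continuousOn_uncurry_fderiv_of_uniform
    (fun t ht => (hw.contDiff_two hk ht).of_le (by norm_num)) fun t ht ε hε => ?_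
  filter_upwards [hw.eventually_norm_iteratedFDeriv_sub_le (j := 1) (by lia) ht hε] with s hs x
  have := hs x
  rwa [← norm_iteratedFDeriv_fderiv, norm_iteratedFDeriv_zero] at this

theorem IsC1Ckc.continuousOn_fderiv_fderiv (hw : IsC1Ckc T k D w) (hk : 2 ≤ k) :
    ContinuousOn (fun p : ℝ × Vec d => fderiv ℝ (fderiv ℝ (w p.1)) p.2) (Icc 0 T ×ˢ univ) := by
  refine continuousOn_uncurry_fderiv_of_uniform (g := fun t => fderiv ℝ (w t))
    (fun t ht => (hw.contDiff_two hk ht).fderiv_right (by norm_num)) fun t ht ε hε => ?_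
  filter_upwards [hw.eventually_norm_iteratedFDeriv_sub_le (j := 2) hk ht hε,
    self_mem_nhdsWithin] with s hs hsI x
  have := hs x
  have hsub : fderiv ℝ (fun x => w s x - w t x)
      = fun x => fderiv ℝ (w s) x - fderiv ℝ (w t) x := by
    funext x
    exact fderiv_fun_sub ((hw.contDiff_two hk hsI).differentiable two_ne_zero x)
      ((hw.contDiff_two hk ht).differentiable two_ne_zero x)
  rwa [← norm_iteratedFDeriv_fderiv, ← norm_iteratedFDeriv_fderiv, norm_iteratedFDeriv_zero,
    hsub] at this

theorem IsC1Ckc.tsupport_fderiv_subset (hw : IsC1Ckc T k D w) :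
    ∀ t ∈ Icc 0 T, tsupport (fderiv ℝ (w t)) ⊆ D := fun t ht =>
  Subset.trans (_root_.tsupport_fderiv_subset ℝ) (hw.1 t ht).subset

theorem IsC1Ckc.tsupport_fderiv_fderiv_subset (hw : IsC1Ckc T k D w) :
    ∀ t ∈ Icc 0 T, tsupport (fderiv ℝ (fderiv ℝ (w t))) ⊆ D := fun t ht =>
  Subset.trans (_root_.tsupport_fderiv_subset ℝ) (hw.tsupport_fderiv_subset t ht)

theorem IsC1Ckc.exists_norm_le (hw : IsC1Ckc T k D w) (hD : Bornology.IsBounded D) :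
    ∃ M, ∀ t ∈ Icc 0 T, ∀ x, ‖w t x‖ ≤ M :=
  exists_bound_of_tsupport_subset hD hw.continuousOn fun t ht => (hw.1 t ht).subset

theorem IsC1Ckc.exists_norm_fderiv_le (hw : IsC1Ckc T k D w) (hk : 2 ≤ k)
    (hD : Bornology.IsBounded D) : ∃ M, ∀ t ∈ Icc 0 T, ∀ x, ‖fderiv ℝ (w t) x‖ ≤ M :=
  exists_bound_of_tsupport_subset (g := fun t => fderiv ℝ (w t)) hD
    (hw.continuousOn_fderiv hk) hw.tsupport_fderiv_subset

theorem IsC1Ckc.exists_norm_fderiv_fderiv_le (hw : IsC1Ckc T k D w) (hk : 2 ≤ k)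
    (hD : Bornology.IsBounded D) :
    ∃ M, ∀ t ∈ Icc 0 T, ∀ x, ‖fderiv ℝ (fderiv ℝ (w t)) x‖ ≤ M :=
  exists_bound_of_tsupport_subset (g := fun t => fderiv ℝ (fderiv ℝ (w t))) hD
    (hw.continuousOn_fderiv_fderiv hk) hw.tsupport_fderiv_fderiv_subset

theorem IsC1Ckc.isC2Field (hw : IsC1Ckc T k D w) (hk : 2 ≤ k) (hD : Bornology.IsBounded D) :
    IsC2Field T w where
  contDiff t ht := hw.contDiff_two hk ht
  continuousOn := hw.continuousOn
  continuousOn_fderiv := hw.continuousOn_fderiv hk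
  continuousOn_fderiv_fderiv := hw.continuousOn_fderiv_fderiv hk
  bounded := by
    obtain ⟨M₀, hM₀⟩ := hw.exists_norm_le hD
    obtain ⟨M₁, hM₁⟩ := hw.exists_norm_fderiv_le hk hD
    obtain ⟨M₂, hM₂⟩ := hw.exists_norm_fderiv_fderiv_le hk hD
    refine ⟨Real.toNNReal (max M₀ (max M₁ M₂)), fun t ht x => ⟨?_, ?_, ?_⟩⟩
    · exact (hM₀ t ht x).trans ((le_max_left _ _).trans (Real.le_coe_toNNReal _))
    · exact (hM₁ t ht x).trans
        (((le_max_left M₁ M₂).trans (le_max_right _ _)).trans (Real.le_coe_toNNReal _))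
    · exact (hM₂ t ht x).trans
        (((le_max_right M₁ M₂).trans (le_max_right _ _)).trans (Real.le_coe_toNNReal _))

theorem IsC1Ckc.clmTrace_fderiv_eq_zero (hw : IsC1Ckc T k D w)
    (hdiv : ∀ t ∈ Icc 0 T, ∀ x ∈ D, tr (jac (w t) x) = 0) {t : ℝ} (ht : t ∈ Icc 0 T) (x : Vec d) :
    clmTrace (fderiv ℝ (w t) x) = 0 := by
  by_cases hx : x ∈ D
  · rw [← tr_jac, hdiv t ht x hx]
  · rw [fderiv_of_notMem_tsupport ℝ fun h => hx ((hw.1 t ht).subset h), map_zero]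

end Velocity

/-! ### Volume preservation by divergence free flows -/

section Liouville

variable {d : ℕ} {T : ℝ} {w : ℝ → Vec d → Vec d}

/-- Liouville's formula: the flow of a divergence free field preserves volume. -/
theorem IsC2Field.det_fderiv_flow (hT : 0 ≤ T) (hw : IsC2Field T w)
    (hdiv : ∀ t ∈ Icc 0 T, ∀ x, clmTrace (fderiv ℝ (w t) x) = 0) {t : ℝ} (ht : t ∈ Icc 0 T)
    (x : Vec d) : (fderiv ℝ (flow T w t) x).det = 1 := by
  have h1 : ∀ t ∈ Icc 0 T,
      HasDerivWithinAt (fun t => (fderiv ℝ (flow T w t) x).det) 0 (Icc 0 T) t := by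
    intro t ht
    have := (differentiable_clm_det (fderiv ℝ (flow T w t) x)).hasFDerivAt.comp_hasDerivWithinAt t
      (hw.hasDerivWithinAt_fderiv_flow hT x ht)
    rwa [fderiv_det_comp, hdiv t ht, zero_mul] at this
  rw [constant_of_has_deriv_right_zero (fun t ht => (h1 t ht).continuousWithinAt)
    (fun t ht => hasDerivWithinAt_Ici_of_Icc (h1 t (Ico_subset_Icc_self ht)) ht) t ht]
  simp only [flow_zero, fderiv_id]
  exact LinearMap.det_id

end Liouville

/-! ### Volume preserving diffeomorphisms -/

section VolDiffeo

variable {d : ℕ} {Φ : Vec d → Vec d}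

/-- `C²` diffeomorphisms of `ℝ^d` with Jacobian determinant one. -/
structure IsVolDiffeo (Φ : Vec d → Vec d) : Prop where
  bijective : Function.Bijective Φ
  contDiff : ContDiff ℝ 2 Φ
  det_fderiv : ∀ x, (fderiv ℝ Φ x).det = 1

/-- The inverse `DΦ(x)⁻¹` of the derivative. -/
noncomputable def invDeriv (Φ : Vec d → Vec d) (x : Vec d) : Vec d →L[ℝ] Vec d :=
  Ring.inverse (fderiv ℝ Φ x)

namespace IsVolDiffeo

theorem hasFDerivAt (h : IsVolDiffeo Φ) (x : Vec d) : HasFDerivAt Φ (fderiv ℝ Φ x) x :=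
  (h.contDiff.differentiable two_ne_zero x).hasFDerivAt

theorem contDiff_fderiv (h : IsVolDiffeo Φ) : ContDiff ℝ 1 (fderiv ℝ Φ) :=
  h.contDiff.fderiv_right (by norm_num)

theorem exists_equiv (h : IsVolDiffeo Φ) (x : Vec d) :
    ∃ e : Vec d ≃L[ℝ] Vec d, (e : Vec d →L[ℝ] Vec d) = fderiv ℝ Φ x :=
  ⟨ContinuousLinearMap.toContinuousLinearEquivOfDetNeZero (fderiv ℝ Φ x)
    (by rw [h.det_fderiv]; exact one_ne_zero), by ext; simp⟩

theorem isUnit_fderiv (h : IsVolDiffeo Φ) (x : Vec d) : IsUnit (fderiv ℝ Φ x) := by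
  obtain ⟨e, he⟩ := h.exists_equiv x
  exact ⟨(ContinuousLinearEquiv.unitsEquiv ℝ _).symm e, he⟩

theorem invDeriv_mul (h : IsVolDiffeo Φ) (x : Vec d) : invDeriv Φ x * fderiv ℝ Φ x = 1 :=
  Ring.inverse_mul_cancel _ (h.isUnit_fderiv x)

theorem mul_invDeriv (h : IsVolDiffeo Φ) (x : Vec d) : fderiv ℝ Φ x * invDeriv Φ x = 1 :=
  Ring.mul_inverse_cancel _ (h.isUnit_fderiv x)

@[simp] theorem invDeriv_fderiv_apply (h : IsVolDiffeo Φ) (x v : Vec d) :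
    invDeriv Φ x (fderiv ℝ Φ x v) = v :=
  DFunLike.congr_fun (h.invDeriv_mul x) v

@[simp] theorem fderiv_invDeriv_apply (h : IsVolDiffeo Φ) (x v : Vec d) :
    fderiv ℝ Φ x (invDeriv Φ x v) = v :=
  DFunLike.congr_fun (h.mul_invDeriv x) v

theorem contDiff_invDeriv (h : IsVolDiffeo Φ) : ContDiff ℝ 1 (invDeriv Φ) :=
  contDiff_iff_contDiffAt.2 fun x => by
    obtain ⟨u, hu⟩ := h.isUnit_fderiv x
    exact (hu ▸ contDiffAt_ringInverse ℝ u :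
      ContDiffAt ℝ 1 Ring.inverse (fderiv ℝ Φ x)).comp x h.contDiff_fderiv.contDiffAt

theorem fderiv_invDeriv (h : IsVolDiffeo Φ) (x k : Vec d) :
    fderiv ℝ (invDeriv Φ) x k = -(invDeriv Φ x * fderiv ℝ (fderiv ℝ Φ) x k * invDeriv Φ x) := by
  obtain ⟨u, hu⟩ := h.isUnit_fderiv x
  have h1 := hasFDerivAt_ringInverse (𝕜 := ℝ) u
  rw [hu] at h1
  have h2 := h1.comp x (h.contDiff_fderiv.differentiable one_ne_zero x).hasFDerivAt
  have h3 : fderiv ℝ (invDeriv Φ) x = _ := h2.fderiv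
  have h4 : (↑u⁻¹ : Vec d →L[ℝ] Vec d) = invDeriv Φ x := by
    rw [invDeriv, ← hu, Ring.inverse_unit]
  rw [h3, h4]
  rfl

/-- Differentiating `det DΦ = 1`. -/
theorem clmTrace_fderiv_fderiv (h : IsVolDiffeo Φ) (x k : Vec d) :
    clmTrace (fderiv ℝ (fderiv ℝ Φ) x k * invDeriv Φ x) = 0 := by
  have h1 := (differentiable_clm_det (fderiv ℝ Φ x)).hasFDerivAt.comp x
    (h.contDiff_fderiv.differentiable one_ne_zero x).hasFDerivAt
  have h2 : HasFDerivAt ((fun A : Vec d →L[ℝ] Vec d => A.det) ∘ fderiv ℝ Φ)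
      (0 : Vec d →L[ℝ] ℝ) x := by
    have : ((fun A : Vec d →L[ℝ] Vec d => A.det) ∘ fderiv ℝ Φ) = fun _ => 1 :=
      funext h.det_fderiv
    rw [this]
    exact hasFDerivAt_const _ _
  have h3 := DFunLike.congr_fun (h1.unique h2) k
  -- Brings the direction into the form `B ∘ DΦ` required by Jacobi's formula.
  have h4 : fderiv ℝ (fderiv ℝ Φ) x k
      = (fderiv ℝ (fderiv ℝ Φ) x k * invDeriv Φ x) ∘L fderiv ℝ Φ x := by
    ext v : 1
    simp [h]
  rw [ContinuousLinearMap.comp_apply, h4, fderiv_det_comp, h.det_fderiv, mul_one] at h3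
  exact h3

/-- The trace of `k ↦ D(DΦ⁻¹)(k) v` vanishes. -/
theorem clmTrace_fderiv_invDeriv_flip (h : IsVolDiffeo Φ) (x v : Vec d) :
    clmTrace ((fderiv ℝ (invDeriv Φ) x).flip v) = 0 := by
  have hs : IsSymmSndFDerivAt ℝ Φ x := h.contDiff.contDiffAt.isSymmSndFDerivAt (by simp)
  -- Symmetry of `D²Φ` moves `k` into the last slot: `D²Φ(k)(DΦ⁻¹ v) = D²Φ(DΦ⁻¹ v)(k)`. Cyclicity of
  -- the trace then reduces the claim to the derivative of `det DΦ = 1` in the direction `DΦ⁻¹ v`.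
  have e : (fderiv ℝ (invDeriv Φ) x).flip v
      = -(invDeriv Φ x ∘L fderiv ℝ (fderiv ℝ Φ) x (invDeriv Φ x v)) := by
    ext k : 1
    simp [h.fderiv_invDeriv, hs.eq k]
  rw [e, map_neg, clmTrace_mul_comm, neg_eq_zero]
  exact h.clmTrace_fderiv_fderiv x _

/-- The homeomorphism underlying a volume preserving diffeomorphism. -/
noncomputable def homeo (h : IsVolDiffeo Φ) : Vec d ≃ₜ Vec d :=
  (Equiv.ofBijective Φ h.bijective).toHomeomorphOfContinuousOpen h.contDiff.continuous
    (by
      choose e he using h.exists_equiv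
      refine isOpenMap_of_hasStrictFDerivAt_equiv (f' := e) fun x => ?_
      rw [he]
      exact h.contDiff.contDiffAt.hasStrictFDerivAt two_ne_zero)

@[simp] theorem coe_homeo (h : IsVolDiffeo Φ) : ⇑h.homeo = Φ := rfl

@[simp] theorem homeo_symm_apply (h : IsVolDiffeo Φ) (x : Vec d) : h.homeo.symm (Φ x) = x :=
  h.homeo.symm_apply_apply x

theorem apply_homeo_symm (h : IsVolDiffeo Φ) (y : Vec d) : Φ (h.homeo.symm y) = y :=
  h.homeo.apply_symm_apply y

theorem contDiff_homeo_symm (h : IsVolDiffeo Φ) : ContDiff ℝ 2 h.homeo.symm := by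
  choose e he using h.exists_equiv
  exact h.homeo.contDiff_symm (f₀' := e) (fun x => by rw [he]; exact h.hasFDerivAt x) h.contDiff

/-- Change of variables with Jacobian one. -/
theorem measurePreserving (h : IsVolDiffeo Φ) {Ω : Set (Vec d)} (hΩ : MeasurableSet Ω) :
    MeasurePreserving h.homeo.toMeasurableEquiv (volume.restrict Ω)
      (volume.restrict (Φ '' Ω)) := by
  refine ⟨h.homeo.toMeasurableEquiv.measurable, ?_⟩
  have := map_withDensity_abs_det_fderiv_eq_addHaar (volume : Measure (Vec d))
    hΩ.nullMeasurableSet (fun x _ => (h.hasFDerivAt x).hasFDerivWithinAt)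
    h.bijective.injective.injOn
  simp only [h.det_fderiv, abs_one, ENNReal.ofReal_one] at this
  rw [← this]
  simp

theorem piola_eq (h : IsVolDiffeo Φ) {Ω : Set (Vec d)} {y : Vec d} (hy : y ∈ Φ '' Ω)
    (u : Vec d → Vec d) :
    piola Ω Φ u y = fderiv ℝ Φ (h.homeo.symm y) (u (h.homeo.symm y)) := by
  have : Function.invFunOn Φ Ω y = h.homeo.symm y := by
    apply h.bijective.injective
    rw [h.apply_homeo_symm]
    exact Function.invFunOn_eq hy
  rw [piola, this]

theorem isCkc_comp (h : IsVolDiffeo Φ) {Ω : Set (Vec d)} {F : Type*} [NormedAddCommGroup F]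
    [NormedSpace ℝ F] {q : Vec d → F} (hq : IsCkc 1 (Φ '' Ω) q) : IsCkc 1 Ω (q ∘ Φ) where
  contDiff := hq.contDiff.comp (h.contDiff.of_le (by norm_num))
  compact := hq.compact.comp_homeomorph h.homeo
  subset := by
    refine (tsupport_comp_subset_preimage q h.contDiff.continuous).trans fun x hx => ?_
    obtain ⟨y, hy, hxy⟩ := hq.subset hx
    rwa [← h.bijective.injective hxy]

theorem isCkc_comp_symm (h : IsVolDiffeo Φ) {Ω : Set (Vec d)} {F : Type*} [NormedAddCommGroup F]
    [NormedSpace ℝ F] {q : Vec d → F} (hq : IsCkc 1 Ω q) :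
    IsCkc 1 (Φ '' Ω) (q ∘ h.homeo.symm) where
  contDiff := hq.contDiff.comp (h.contDiff_homeo_symm.of_le (by norm_num))
  compact := hq.compact.comp_homeomorph h.homeo.symm
  subset := by
    refine (tsupport_comp_subset_preimage q h.homeo.symm.continuous).trans fun y hy => ?_
    exact ⟨h.homeo.symm y, hq.subset hy, h.apply_homeo_symm y⟩

/-- The chain rule. It is the reason why `DΦᵀ` is the right coefficient on the dual side: the
covariant transform maps gradients to gradients. -/
theorem gradient_comp (h : IsVolDiffeo Φ) {q : Vec d → ℝ} (hq : Differentiable ℝ q) (x : Vec d) :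
    gradient (q ∘ Φ) x = ContinuousLinearMap.adjoint (fderiv ℝ Φ x) (gradient q (Φ x)) := by
  refine ext_inner_right ℝ fun v => ?_
  rw [ContinuousLinearMap.adjoint_inner_left, gradient, gradient,
    InnerProductSpace.toDual_symm_apply, InnerProductSpace.toDual_symm_apply,
    fderiv_comp x (hq _) (h.hasFDerivAt x).differentiableAt]
  rfl

end IsVolDiffeo

theorem IsCkc.clm_apply {Ω : Set (Vec d)} {F G : Type*} [NormedAddCommGroup F] [NormedSpace ℝ F]
    [NormedAddCommGroup G] [NormedSpace ℝ G] {N : Vec d → F →L[ℝ] G} {v : Vec d → F}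
    (hN : ContDiff ℝ 1 N) (hv : IsCkc 1 Ω v) : IsCkc 1 Ω fun x => N x (v x) := by
  have hs : tsupport (fun x => N x (v x)) ⊆ tsupport v := by
    refine closure_mono fun x hx hv => hx ?_
    simp only [hv, map_zero]
  exact ⟨hN.clm_apply hv.contDiff, hv.compact.of_isClosed_subset (isClosed_tsupport _) hs,
    hs.trans hv.subset⟩

theorem IsC2Field.isVolDiffeo_flow {T : ℝ} {w : ℝ → Vec d → Vec d} (hT : 0 ≤ T)
    (hw : IsC2Field T w) (hdiv : ∀ t ∈ Icc 0 T, ∀ x, clmTrace (fderiv ℝ (w t) x) = 0) {t : ℝ}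
    (ht : t ∈ Icc 0 T) : IsVolDiffeo (flow T w t) :=
  ⟨hw.bijective_flow hT ht, hw.contDiff_flow hT ht, hw.det_fderiv_flow hT hdiv ht⟩

end VolDiffeo

/-! ### Multiplication operators on `L²` -/

section MulOp

variable {d : ℕ} {Ω : Set (Vec d)} {F G K : Type*}
  [NormedAddCommGroup F] [NormedSpace ℝ F] [NormedAddCommGroup G] [NormedSpace ℝ G]
  [NormedAddCommGroup K] [NormedSpace ℝ K]

/-- Measurable sets with compact closure. -/
structure IsPrecompact (Ω : Set (Vec d)) : Prop where
  measurableSet : MeasurableSet Ω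
  isCompact_closure : IsCompact (closure Ω)

theorem IsPrecompact.exists_bound {F : Type*} [NormedAddCommGroup F] (hΩ : IsPrecompact Ω)
    {a : Vec d → F} (ha : Continuous a) :
    ∃ C, 0 ≤ C ∧ ∀ x ∈ Ω, ‖a x‖ ≤ C := by
  obtain ⟨C, hC⟩ := hΩ.isCompact_closure.exists_bound_of_continuousOn ha.continuousOn
  exact ⟨max C 0, le_max_right _ _, fun x hx => (hC x (subset_closure hx)).trans (le_max_left _ _)⟩

theorem IsPrecompact.memLp_mul (hΩ : IsPrecompact Ω) {a : Vec d → F →L[ℝ] G} (ha : Continuous a)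
    (u : Lp F 2 (volume.restrict Ω)) :
    MemLp (fun x => a x (u x)) 2 (volume.restrict Ω) := by
  obtain ⟨C, hC0, hC⟩ := hΩ.exists_bound ha
  refine (Lp.memLp u).of_le_mul (c := C) ?_ ?_
  · exact isBoundedBilinearMap_apply.continuous.comp_aestronglyMeasurable
      (ha.aestronglyMeasurable.prodMk (Lp.aestronglyMeasurable u))
  · filter_upwards [ae_restrict_mem hΩ.measurableSet] with x hx
    exact (a x).le_of_opNorm_le (hC x hx) _

open Classical in
/-- Pointwise multiplication of `u ∈ L²(Ω)` by a continuous coefficient. -/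
noncomputable def mulOp (Ω : Set (Vec d)) (a : Vec d → F →L[ℝ] G) :
    Lp F 2 (volume.restrict Ω) →L[ℝ] Lp G 2 (volume.restrict Ω) :=
  -- The default value `0` keeps the operator total, so that a family of coefficients may be indexed
  -- by all real `t` although it is continuous in space only for `t ∈ [0,T]`.
  if h : IsPrecompact Ω ∧ Continuous a then
    LinearMap.mkContinuousOfExistsBound
      { toFun := fun u => (h.1.memLp_mul h.2 u).toLp
        map_add' := fun u v => by
          rw [← MemLp.toLp_add]
          refine MemLp.toLp_congr _ _ ?_
          filter_upwards [Lp.coeFn_add u v] with x hx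
          rw [hx, Pi.add_apply, Pi.add_apply, map_add]
        map_smul' := fun c u => by
          rw [RingHom.id_apply, ← MemLp.toLp_const_smul]
          refine MemLp.toLp_congr _ _ ?_
          filter_upwards [Lp.coeFn_smul c u] with x hx
          simp [hx] }
      (by
        obtain ⟨C, hC0, hC⟩ := h.1.exists_bound h.2
        refine ⟨C, fun u => Lp.norm_le_mul_norm_of_ae_le_mul ?_⟩
        filter_upwards [ae_restrict_mem h.1.measurableSet, (h.1.memLp_mul h.2 u).coeFn_toLp]
          with x hx hx'
        simp only [LinearMap.coe_mk, AddHom.coe_mk, hx']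
        exact (a x).le_of_opNorm_le (hC x hx) _)
  else 0

theorem coeFn_mulOp (hΩ : IsPrecompact Ω) {a : Vec d → F →L[ℝ] G} (ha : Continuous a)
    (u : Lp F 2 (volume.restrict Ω)) :
    mulOp Ω a u =ᵐ[volume.restrict Ω] fun x => a x (u x) := by
  rw [mulOp, dif_pos ⟨hΩ, ha⟩]
  exact (hΩ.memLp_mul ha u).coeFn_toLp

theorem norm_mulOp_sub_le (hΩ : IsPrecompact Ω) {a b : Vec d → F →L[ℝ] G} (ha : Continuous a)
    (hb : Continuous b) {C : ℝ} (hC0 : 0 ≤ C) (hC : ∀ x ∈ Ω, ‖a x - b x‖ ≤ C) :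
    ‖mulOp Ω a - mulOp Ω b‖ ≤ C := by
  refine ContinuousLinearMap.opNorm_le_bound _ hC0 fun u => Lp.norm_le_mul_norm_of_ae_le_mul ?_
  filter_upwards [ae_restrict_mem hΩ.measurableSet, coeFn_mulOp hΩ ha u, coeFn_mulOp hΩ hb u,
    Lp.coeFn_sub (mulOp Ω a u) (mulOp Ω b u)] with x hx h1 h2 h3
  rw [sub_apply, h3, Pi.sub_apply, h1, h2, ← sub_apply]
  exact (a x - b x).le_of_opNorm_le (hC x hx) _

theorem mulOp_mulOp (hΩ : IsPrecompact Ω) {a : Vec d → G →L[ℝ] K} {b : Vec d → F →L[ℝ] G}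
    (ha : Continuous a) (hb : Continuous b) :
    mulOp Ω a ∘L mulOp Ω b = mulOp Ω fun x => a x ∘L b x := by
  ext1 u
  refine Lp.ext ?_
  filter_upwards [coeFn_mulOp hΩ ha (mulOp Ω b u), coeFn_mulOp hΩ hb u,
    coeFn_mulOp hΩ (ha.clm_comp hb) u] with x h1 h2 h3
  rw [ContinuousLinearMap.comp_apply, h1, h2, h3, ContinuousLinearMap.comp_apply]

theorem mulOp_id (hΩ : IsPrecompact Ω) :
    mulOp Ω (fun _ => ContinuousLinearMap.id ℝ F) = ContinuousLinearMap.id ℝ _ := by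
  ext1 u
  refine Lp.ext ?_
  filter_upwards [coeFn_mulOp hΩ (continuous_const (y := ContinuousLinearMap.id ℝ F)) u] with x h1
  rw [h1]
  rfl

theorem mulOp_mulOp_of_inverse (hΩ : IsPrecompact Ω) {a : Vec d → G →L[ℝ] F}
    {b : Vec d → F →L[ℝ] G} (ha : Continuous a) (hb : Continuous b)
    (h : ∀ x, a x ∘L b x = ContinuousLinearMap.id ℝ F) :
    mulOp Ω a ∘L mulOp Ω b = ContinuousLinearMap.id ℝ _ := by
  rw [mulOp_mulOp hΩ ha hb, funext h, mulOp_id hΩ]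

/-- The operator norm is controlled by the supremum of the coefficient over `Ω`, and joint
continuity is uniform over the compact closure of `Ω`. -/
theorem continuousOn_mulOp (hΩ : IsPrecompact Ω) {S : Set ℝ} {a : ℝ → Vec d → F →L[ℝ] G}
    (ha : ContinuousOn (fun p : ℝ × Vec d => a p.1 p.2) (S ×ˢ univ)) :
    ContinuousOn (fun t => mulOp Ω (a t)) S := by
  have hat : ∀ t ∈ S, Continuous (a t) := fun t ht => by
    rw [← continuousOn_univ]
    exact ha.comp (f := fun x => (t, x)) (by fun_prop) fun x _ => ⟨ht, trivial⟩
  intro t ht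
  refine Metric.tendsto_nhds.2 fun ε hε => ?_
  filter_upwards [hΩ.isCompact_closure.eventually_forall_dist_lt
    (ha.mono (prod_mono_right (subset_univ _))) ht (half_pos hε), self_mem_nhdsWithin] with s hs hsS
  rw [dist_eq_norm]
  refine (norm_mulOp_sub_le hΩ (hat s hsS) (hat t ht) (half_pos hε).le fun x hx => ?_).trans_lt
    (half_lt_self hε)
  rw [← dist_eq_norm]
  exact (hs x (subset_closure hx)).le

end MulOp

/-! ### Triangular operators on pairs -/

section PairOp

variable {d : ℕ} {Ω : Set (Vec d)}

/-- The operator `(u, G) ↦ (a u, b u + c G)` on `L²` pairs. -/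
noncomputable def pairOp (Ω : Set (Vec d)) (a : Vec d → Vec d →L[ℝ] Vec d)
    (b : Vec d → Vec d →L[ℝ] Mat d) (c : Vec d → Mat d →L[ℝ] Mat d) : L2Pair Ω →L[ℝ] L2Pair Ω :=
  ((WithLp.prodContinuousLinearEquiv 2 ℝ (L2 Ω) (L2Mat Ω)).symm :
      L2 Ω × L2Mat Ω →L[ℝ] L2Pair Ω) ∘L
    ((mulOp Ω a ∘L ContinuousLinearMap.fst ℝ (L2 Ω) (L2Mat Ω)).prod
      (mulOp Ω b ∘L ContinuousLinearMap.fst ℝ (L2 Ω) (L2Mat Ω) +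
        mulOp Ω c ∘L ContinuousLinearMap.snd ℝ (L2 Ω) (L2Mat Ω))) ∘L
    (WithLp.prodContinuousLinearEquiv 2 ℝ (L2 Ω) (L2Mat Ω) : L2Pair Ω →L[ℝ] L2 Ω × L2Mat Ω)

variable {a a' : Vec d → Vec d →L[ℝ] Vec d} {b : Vec d → Vec d →L[ℝ] Mat d}
  {c c' : Vec d → Mat d →L[ℝ] Mat d}

@[simp] theorem pairOp_fst (z : L2Pair Ω) : (pairOp Ω a b c z).fst = mulOp Ω a z.fst := rfl

@[simp] theorem pairOp_snd (z : L2Pair Ω) :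
    (pairOp Ω a b c z).snd = mulOp Ω b z.fst + mulOp Ω c z.snd := rfl

theorem L2Pair.ext {y z : L2Pair Ω} (h₁ : y.fst = z.fst) (h₂ : y.snd = z.snd) : y = z := by
  have : WithLp.ofLp y = WithLp.ofLp z := Prod.ext h₁ h₂
  exact WithLp.ofLp_injective 2 this

theorem L2Pair.ext_ae {y z : L2Pair Ω} (h₁ : y.fst =ᵐ[volume.restrict Ω] z.fst)
    (h₂ : y.snd =ᵐ[volume.restrict Ω] z.snd) : y = z :=
  L2Pair.ext (Lp.ext h₁) (Lp.ext h₂)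

/-- A triangular operator with invertible diagonal is inverted explicitly, with off-diagonal entry
`-c⁻¹ b a⁻¹`. -/
theorem isUnit_pairOp (hΩ : IsPrecompact Ω) (ha : Continuous a) (ha' : Continuous a')
    (hb : Continuous b) (hc : Continuous c) (hc' : Continuous c')
    (h₁ : ∀ x, a x ∘L a' x = ContinuousLinearMap.id ℝ _)
    (h₂ : ∀ x, a' x ∘L a x = ContinuousLinearMap.id ℝ _)
    (h₃ : ∀ x, c x ∘L c' x = ContinuousLinearMap.id ℝ _)
    (h₄ : ∀ x, c' x ∘L c x = ContinuousLinearMap.id ℝ _) : IsUnit (pairOp Ω a b c) := by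
  have e₁ := fun u => DFunLike.congr_fun (mulOp_mulOp_of_inverse hΩ ha ha' h₁) u
  have e₂ := fun u => DFunLike.congr_fun (mulOp_mulOp_of_inverse hΩ ha' ha h₂) u
  have e₃ := fun u => DFunLike.congr_fun (mulOp_mulOp_of_inverse hΩ hc hc' h₃) u
  have e₄ := fun u => DFunLike.congr_fun (mulOp_mulOp_of_inverse hΩ hc' hc h₄) u
  simp only [ContinuousLinearMap.comp_apply, ContinuousLinearMap.id_apply] at e₁ e₂ e₃ e₄
  have hb' : Continuous fun x => -(c' x ∘L b x ∘L a' x) :=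
    (hc'.clm_comp (hb.clm_comp ha')).neg
  have e₅ : ∀ u, mulOp Ω (fun x => -(c' x ∘L b x ∘L a' x)) u
      = -mulOp Ω c' (mulOp Ω b (mulOp Ω a' u)) := fun u => by
    refine Lp.ext ?_
    filter_upwards [coeFn_mulOp hΩ hb' u, coeFn_mulOp hΩ hc' (mulOp Ω b (mulOp Ω a' u)),
      coeFn_mulOp hΩ hb (mulOp Ω a' u), coeFn_mulOp hΩ ha' u,
      Lp.coeFn_neg (mulOp Ω c' (mulOp Ω b (mulOp Ω a' u)))] with x h1 h2 h3 h4 h5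
    rw [h1, h5, Pi.neg_apply, h2, h3, h4]
    rfl
  refine isUnit_iff_exists.2 ⟨pairOp Ω a' (fun x => -(c' x ∘L b x ∘L a' x)) c', ?_, ?_⟩
  · ext1 z
    refine L2Pair.ext ?_ ?_
    · simp [e₁]
    · simp [e₅, e₃]
  · ext1 z
    refine L2Pair.ext ?_ ?_
    · simp [e₂]
    · simp [e₅, e₂, e₄]

theorem continuousOn_pairOp (hΩ : IsPrecompact Ω) {S : Set ℝ} {a : ℝ → Vec d → Vec d →L[ℝ] Vec d}
    {b : ℝ → Vec d → Vec d →L[ℝ] Mat d} {c : ℝ → Vec d → Mat d →L[ℝ] Mat d}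
    (ha : ContinuousOn (fun p : ℝ × Vec d => a p.1 p.2) (S ×ˢ univ))
    (hb : ContinuousOn (fun p : ℝ × Vec d => b p.1 p.2) (S ×ˢ univ))
    (hc : ContinuousOn (fun p : ℝ × Vec d => c p.1 p.2) (S ×ˢ univ)) :
    ContinuousOn (fun t => pairOp Ω (a t) (b t) (c t)) S :=
  continuousOn_const.clm_comp ((continuousOn_clm_prod
    ((continuousOn_mulOp hΩ ha).clm_comp continuousOn_const)
    (((continuousOn_mulOp hΩ hb).clm_comp continuousOn_const).add
      ((continuousOn_mulOp hΩ hc).clm_comp continuousOn_const))).clm_comp continuousOn_const)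

end PairOp

/-! ### Composition with measure preserving maps -/

section Pull

variable {d : ℕ} {Ω Ω' : Set (Vec d)} {F : Type*} [NormedAddCommGroup F] [NormedSpace ℝ F]

/-- Composition with a measure preserving equivalence, as an isometry of `L²` spaces. -/
noncomputable def pull (e : Vec d ≃ᵐ Vec d)
    (he : MeasurePreserving e (volume.restrict Ω) (volume.restrict Ω')) :
    Lp F 2 (volume.restrict Ω') ≃ₗᵢ[ℝ] Lp F 2 (volume.restrict Ω) :=
  LinearIsometryEquiv.ofSurjective (Lp.compMeasurePreservingₗᵢ ℝ e he) fun u => by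
    refine ⟨Lp.compMeasurePreserving e.symm he.symm u, Lp.ext ?_⟩
    have h1 := Lp.coeFn_compMeasurePreserving (Lp.compMeasurePreserving e.symm he.symm u) he
    have h2 := he.quasiMeasurePreserving.ae_eq_comp
      (Lp.coeFn_compMeasurePreserving u he.symm)
    refine h1.trans (h2.trans ?_)
    exact Eventually.of_forall fun x => by simp

variable {e : Vec d ≃ᵐ Vec d} (he : MeasurePreserving e (volume.restrict Ω) (volume.restrict Ω'))

theorem coeFn_pull (u : Lp F 2 (volume.restrict Ω')) :
    pull e he u =ᵐ[volume.restrict Ω] u ∘ e :=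
  Lp.coeFn_compMeasurePreserving u he

/-- Composition with a measure preserving equivalence on pairs. -/
noncomputable def pullPair (e : Vec d ≃ᵐ Vec d)
    (he : MeasurePreserving e (volume.restrict Ω) (volume.restrict Ω')) :
    L2Pair Ω' ≃ₗᵢ[ℝ] L2Pair Ω where
  toLinearEquiv := (WithLp.prodContinuousLinearEquiv 2 ℝ (L2 Ω') (L2Mat Ω')).toLinearEquiv.trans
    (((pull e he).toLinearEquiv.prodCongr (pull e he).toLinearEquiv).trans
      (WithLp.prodContinuousLinearEquiv 2 ℝ (L2 Ω) (L2Mat Ω)).symm.toLinearEquiv)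
  norm_map' z := by
    rw [WithLp.prod_norm_eq_of_L2, WithLp.prod_norm_eq_of_L2]
    have h1 : ‖pull e he z.fst‖ = ‖z.fst‖ := (pull e he).norm_map _
    have h2 : ‖pull e he z.snd‖ = ‖z.snd‖ := (pull e he).norm_map _
    rw [← h1, ← h2]
    rfl

theorem pullPair_fst (z : L2Pair Ω') : (pullPair e he z).fst = pull e he z.fst := rfl

theorem pullPair_snd (z : L2Pair Ω') : (pullPair e he z).snd = pull e he z.snd := rfl

end Pull

/-! ### Piola transforms of Sobolev functions -/

section Sobolev

variable {d : ℕ}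

/-- The identification of continuous linear maps with matrices, so that `jac u = matEquiv ∘ Du`. -/
noncomputable def matEquiv : (Vec d →L[ℝ] Vec d) ≃L[ℝ] Mat d :=
  LinearEquiv.toContinuousLinearEquiv
    { toFun := fun A => WithLp.toLp 2 fun p => A (EuclideanSpace.single p.2 1) p.1
      map_add' := fun A B => by ext p; simp
      map_smul' := fun c A => by ext p; simp
      invFun := fun G => (Matrix.toEuclideanLin (Matrix.of fun i j => G (i, j))).toContinuousLinearMap
      left_inv := fun A => by
        refine ContinuousLinearMap.coe_injective
          ((EuclideanSpace.basisFun (Fin d) ℝ).toBasis.ext fun j => ?_)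
        ext i
        simp [Matrix.toLpLin_apply, Matrix.mulVec_single]
      right_inv := fun G => by
        ext p
        simp [Matrix.toLpLin_apply, Matrix.mulVec_single] }

theorem jac_eq (u : Vec d → Vec d) (x : Vec d) : jac u x = matEquiv (fderiv ℝ u x) := rfl

theorem tr_matEquiv (A : Vec d →L[ℝ] Vec d) : tr (matEquiv A) = clmTrace A := by
  rw [clmTrace_apply]
  rfl

/-- The zeroth order coefficient in the derivative of `N (v ∘ Φ)`. -/
noncomputable def sobB (N : Vec d → Vec d →L[ℝ] Vec d) (x : Vec d) : Vec d →L[ℝ] Mat d :=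
  (matEquiv (d := d) : (Vec d →L[ℝ] Vec d) →L[ℝ] Mat d) ∘L (fderiv ℝ N x).flip

/-- The map `G ↦ A G B` on matrices. -/
noncomputable def matConj (A B : Vec d →L[ℝ] Vec d) : Mat d →L[ℝ] Mat d :=
  (matEquiv (d := d) : (Vec d →L[ℝ] Vec d) →L[ℝ] Mat d) ∘L
    (ContinuousLinearMap.compL ℝ (Vec d) (Vec d) (Vec d) A ∘L
      (ContinuousLinearMap.compL ℝ (Vec d) (Vec d) (Vec d)).flip B) ∘L
    ((matEquiv (d := d)).symm : Mat d →L[ℝ] (Vec d →L[ℝ] Vec d))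

theorem matConj_apply (A B : Vec d →L[ℝ] Vec d) (G : Mat d) :
    matConj A B G = matEquiv (A ∘L matEquiv.symm G ∘L B) := rfl

theorem matConj_comp {A A' B B' : Vec d →L[ℝ] Vec d} (hA : A ∘L A' = ContinuousLinearMap.id ℝ _)
    (hB : B' ∘L B = ContinuousLinearMap.id ℝ _) :
    matConj A B ∘L matConj A' B' = ContinuousLinearMap.id ℝ _ := by
  ext1 G
  simp only [ContinuousLinearMap.comp_apply, matConj_apply, ContinuousLinearEquiv.symm_apply_apply,
    ContinuousLinearMap.id_apply]
  have : A ∘L (A' ∘L matEquiv.symm G ∘L B') ∘L B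
      = (A ∘L A') ∘L matEquiv.symm G ∘L (B' ∘L B) := rfl
  rw [this, hA, hB, ContinuousLinearMap.id_comp, ContinuousLinearMap.comp_id,
    ContinuousLinearEquiv.apply_symm_apply]

theorem continuousOn_matConj {X : Type*} [TopologicalSpace X] {A B : X → Vec d →L[ℝ] Vec d}
    {S : Set X} (hA : ContinuousOn A S) (hB : ContinuousOn B S) :
    ContinuousOn (fun x => matConj (A x) (B x)) S :=
  continuousOn_const.clm_comp
    ((((ContinuousLinearMap.compL ℝ (Vec d) (Vec d) (Vec d)).continuous.comp_continuousOn
      hA).clm_comp ((ContinuousLinearMap.compL ℝ (Vec d) (Vec d)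
        (Vec d)).flip.continuous.comp_continuousOn hB)).clm_comp continuousOn_const)

theorem continuousOn_matEquiv_flip {X : Type*} [TopologicalSpace X]
    {A : X → Vec d →L[ℝ] Vec d →L[ℝ] Vec d} {S : Set X} (hA : ContinuousOn A S) :
    ContinuousOn (fun x => (matEquiv (d := d) : (Vec d →L[ℝ] Vec d) →L[ℝ] Mat d) ∘L (A x).flip) S :=
  continuousOn_const.clm_comp
    ((ContinuousLinearMap.flipₗᵢ ℝ (Vec d) (Vec d) (Vec d)).continuous.comp_continuousOn hA)

/-- Continuously differentiable fields of invertible matrices. -/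
structure IsFrame (N N' : Vec d → Vec d →L[ℝ] Vec d) : Prop where
  contDiff : ContDiff ℝ 1 N
  contDiff' : ContDiff ℝ 1 N'
  comp_eq : ∀ x, N x ∘L N' x = ContinuousLinearMap.id ℝ _
  comp_eq' : ∀ x, N' x ∘L N x = ContinuousLinearMap.id ℝ _

theorem IsFrame.apply_apply {N N' : Vec d → Vec d →L[ℝ] Vec d} (hN : IsFrame N N') (x v : Vec d) :
    N x (N' x v) = v :=
  DFunLike.congr_fun (hN.comp_eq x) v

theorem IsFrame.apply_apply' {N N' : Vec d → Vec d →L[ℝ] Vec d} (hN : IsFrame N N')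
    (x v : Vec d) : N' x (N x v) = v :=
  DFunLike.congr_fun (hN.comp_eq' x) v

theorem IsVolDiffeo.isFrame_invDeriv {Φ : Vec d → Vec d} (h : IsVolDiffeo Φ) :
    IsFrame (invDeriv Φ) (fderiv ℝ Φ) :=
  ⟨h.contDiff_invDeriv, h.contDiff_fderiv, h.invDeriv_mul, h.mul_invDeriv⟩

theorem contDiff_adjoint {N : Vec d → Vec d →L[ℝ] Vec d} (hN : ContDiff ℝ 1 N) :
    ContDiff ℝ 1 fun x => ContinuousLinearMap.adjoint (N x) :=
  (ContinuousLinearMap.adjoint (𝕜 := ℝ) (E := Vec d)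
    (F := Vec d)).toContinuousLinearEquiv.contDiff.comp hN

/-- Applied to the pair `DΦ⁻¹`, `DΦ` of the inverse Piola transform, this yields the frame `DΦᵀ` of
the covariant transform, with inverse `DΦ⁻ᵀ`. -/
theorem IsFrame.adjoint {N N' : Vec d → Vec d →L[ℝ] Vec d} (hN : IsFrame N N') :
    IsFrame (fun x => ContinuousLinearMap.adjoint (N' x))
      fun x => ContinuousLinearMap.adjoint (N x) :=
  ⟨contDiff_adjoint hN.contDiff', contDiff_adjoint hN.contDiff,
    fun x => by rw [← ContinuousLinearMap.adjoint_comp, hN.comp_eq, ContinuousLinearMap.adjoint_id],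
    fun x => by
      rw [← ContinuousLinearMap.adjoint_comp, hN.comp_eq', ContinuousLinearMap.adjoint_id]⟩

/-- The operator on pairs that maps `(v ∘ Φ, (Dv) ∘ Φ)` to `N (v ∘ Φ)` and its derivative. -/
noncomputable def sobOp (Ω : Set (Vec d)) (Φ : Vec d → Vec d) (N : Vec d → Vec d →L[ℝ] Vec d) :
    L2Pair Ω →L[ℝ] L2Pair Ω :=
  pairOp Ω N (sobB N) fun x => matConj (N x) (fderiv ℝ Φ x)

variable {Ω Ω' : Set (Vec d)} {Φ : Vec d → Vec d} {N N' : Vec d → Vec d →L[ℝ] Vec d}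

theorem IsFrame.continuous_sobB (hN : IsFrame N N') : Continuous (sobB N) := by
  rw [← continuousOn_univ]
  exact continuousOn_matEquiv_flip (hN.contDiff.continuous_fderiv one_ne_zero).continuousOn

theorem IsFrame.continuous_matConj (hN : IsFrame N N') (h : IsVolDiffeo Φ) :
    Continuous fun x => matConj (N x) (fderiv ℝ Φ x) := by
  rw [← continuousOn_univ]
  exact continuousOn_matConj hN.contDiff.continuous.continuousOn
    h.contDiff_fderiv.continuous.continuousOn

theorem isUnit_sobOp (hΩ : IsPrecompact Ω) (h : IsVolDiffeo Φ) (hN : IsFrame N N') :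
    IsUnit (sobOp Ω Φ N) :=
  isUnit_pairOp hΩ hN.contDiff.continuous hN.contDiff'.continuous hN.continuous_sobB
    (hN.continuous_matConj h)
    (c' := fun x => matConj (N' x) (invDeriv Φ x))
    (by
      rw [← continuousOn_univ]
      exact continuousOn_matConj hN.contDiff'.continuous.continuousOn
        h.contDiff_invDeriv.continuous.continuousOn) hN.comp_eq hN.comp_eq'
    (fun x => matConj_comp (hN.comp_eq x) (h.invDeriv_mul x))
    (fun x => matConj_comp (hN.comp_eq' x) (h.mul_invDeriv x))

theorem sobOp_fst (hΩ : IsPrecompact Ω) (hN : IsFrame N N') (z : L2Pair Ω) :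
    (sobOp Ω Φ N z).fst =ᵐ[volume.restrict Ω] fun x => N x (z.fst x) :=
  coeFn_mulOp hΩ hN.contDiff.continuous z.fst

theorem sobOp_snd (hΩ : IsPrecompact Ω) (h : IsVolDiffeo Φ) (hN : IsFrame N N') (z : L2Pair Ω) :
    (sobOp Ω Φ N z).snd =ᵐ[volume.restrict Ω] fun x => matEquiv ((fderiv ℝ N x).flip (z.fst x)
      + N x ∘L matEquiv.symm (z.snd x) ∘L fderiv ℝ Φ x) := by
  filter_upwards [coeFn_mulOp hΩ hN.continuous_sobB z.fst,
    coeFn_mulOp hΩ (hN.continuous_matConj h) z.snd,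
    Lp.coeFn_add (mulOp Ω (sobB N) z.fst) (mulOp Ω (fun x => matConj (N x) (fderiv ℝ Φ x)) z.snd)]
    with x h1 h2 h3
  rw [sobOp, pairOp_snd, h3, Pi.add_apply, h1, h2, map_add]
  rfl

theorem IsCkc.exists_mem_smoothPairs {v : Vec d → Vec d} (hv : IsCkc 1 Ω v) :
    ∃ z ∈ smoothPairs Ω, z.fst =ᵐ[volume.restrict Ω] v ∧ z.snd =ᵐ[volume.restrict Ω] jac v := by
  have h1 : MemLp v 2 (volume.restrict Ω) :=
    (hv.contDiff.continuous.memLp_of_hasCompactSupport hv.compact).restrict _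
  have h2 : MemLp (jac v) 2 (volume.restrict Ω) := by
    have hc : Continuous (jac v) :=
      matEquiv.continuous.comp (hv.contDiff.continuous_fderiv one_ne_zero)
    have hs : HasCompactSupport (jac v) :=
      (hv.compact.fderiv (𝕜 := ℝ)).comp_left (g := matEquiv) (map_zero _)
    exact (hc.memLp_of_hasCompactSupport hs).restrict _
  exact ⟨WithLp.toLp 2 (h1.toLp, h2.toLp), ⟨v, hv, h1.coeFn_toLp, h2.coeFn_toLp⟩,
    h1.coeFn_toLp, h2.coeFn_toLp⟩

/-- Product and chain rule; the two summands are the coefficients of the second row of `sobOp`. -/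
theorem IsVolDiffeo.fderiv_frame_comp (h : IsVolDiffeo Φ) (hN : IsFrame N N') {v : Vec d → Vec d}
    (hv : ContDiff ℝ 1 v) (x : Vec d) : fderiv ℝ (fun x => N x (v (Φ x))) x
      = (fderiv ℝ N x).flip (v (Φ x)) + N x ∘L fderiv ℝ v (Φ x) ∘L fderiv ℝ Φ x := by
  have h1 := (hN.contDiff.differentiable one_ne_zero x).hasFDerivAt.clm_apply
    ((hv.differentiable one_ne_zero (Φ x)).hasFDerivAt.comp x (h.hasFDerivAt x))
  refine h1.fderiv.trans ?_
  rw [add_comm]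
  rfl

theorem IsVolDiffeo.ae_comp (h : IsVolDiffeo Φ)
    (he : MeasurePreserving h.homeo.toMeasurableEquiv (volume.restrict Ω) (volume.restrict Ω'))
    {p : Vec d → Prop} (hp : ∀ᵐ y ∂volume.restrict Ω', p y) :
    ∀ᵐ x ∂volume.restrict Ω, p (Φ x) :=
  he.quasiMeasurePreserving.ae hp

theorem IsVolDiffeo.ae_of_ae_comp (h : IsVolDiffeo Φ)
    (he : MeasurePreserving h.homeo.toMeasurableEquiv (volume.restrict Ω) (volume.restrict Ω'))
    {p : Vec d → Prop} (hp : ∀ᵐ x ∂volume.restrict Ω, p (Φ x)) :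
    ∀ᵐ y ∂volume.restrict Ω', p y := by
  filter_upwards [he.symm.quasiMeasurePreserving.ae hp] with y hy
  have e : Φ (h.homeo.toMeasurableEquiv.symm y) = y := h.homeo.apply_symm_apply y
  rwa [e] at hy

theorem sobPull_fst (h : IsVolDiffeo Φ)
    (he : MeasurePreserving h.homeo.toMeasurableEquiv (volume.restrict Ω) (volume.restrict Ω'))
    (hΩ : IsPrecompact Ω) (hN : IsFrame N N') (z : L2Pair Ω') :
    (sobOp Ω Φ N (pullPair _ he z)).fst =ᵐ[volume.restrict Ω] fun x => N x (z.fst (Φ x)) := by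
  filter_upwards [sobOp_fst (Φ := Φ) hΩ hN (pullPair _ he z), coeFn_pull he z.fst] with x h1 h2
  rw [h1, pullPair_fst, h2]
  rfl

theorem sobPull_snd (h : IsVolDiffeo Φ)
    (he : MeasurePreserving h.homeo.toMeasurableEquiv (volume.restrict Ω) (volume.restrict Ω'))
    (hΩ : IsPrecompact Ω) (hN : IsFrame N N') (z : L2Pair Ω') :
    (sobOp Ω Φ N (pullPair _ he z)).snd =ᵐ[volume.restrict Ω] fun x =>
      matEquiv ((fderiv ℝ N x).flip (z.fst (Φ x))
        + N x ∘L matEquiv.symm (z.snd (Φ x)) ∘L fderiv ℝ Φ x) := by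
  filter_upwards [sobOp_snd hΩ h hN (pullPair _ he z), coeFn_pull he z.fst,
    coeFn_pull he z.snd] with x h1 h2 h3
  rw [h1, pullPair_fst, pullPair_snd, h2, h3]
  rfl

theorem sobPull_of_ae_eq (h : IsVolDiffeo Φ)
    (he : MeasurePreserving h.homeo.toMeasurableEquiv (volume.restrict Ω) (volume.restrict Ω'))
    (hΩ : IsPrecompact Ω) (hN : IsFrame N N') {z : L2Pair Ω'}
    {v : Vec d → Vec d} (hv : ContDiff ℝ 1 v) (h₁ : z.fst =ᵐ[volume.restrict Ω'] v)
    (h₂ : z.snd =ᵐ[volume.restrict Ω'] jac v) :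
    (sobOp Ω Φ N (pullPair _ he z)).fst =ᵐ[volume.restrict Ω] (fun x => N x (v (Φ x))) ∧
    (sobOp Ω Φ N (pullPair _ he z)).snd =ᵐ[volume.restrict Ω] jac fun x => N x (v (Φ x)) := by
  constructor
  · filter_upwards [sobPull_fst h he hΩ hN z, h.ae_comp he h₁] with x e1 e2
    rw [e1, e2]
  · filter_upwards [sobPull_snd h he hΩ hN z, h.ae_comp he h₁, h.ae_comp he h₂] with x e1 e2 e3
    rw [e1, e2, e3, jac_eq, jac_eq, h.fderiv_frame_comp hN hv,
      ContinuousLinearEquiv.symm_apply_apply]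

/-- As `N` and `Φ` are `C¹`, the transform preserves `C¹_c`. Conversely `u` comes from `v = (N⁻¹ u)
∘ Φ⁻¹`, and injectivity of the operator identifies `z` with the pair of `v`. -/
theorem sobPull_mem_smoothPairs_iff (h : IsVolDiffeo Φ)
    (he : MeasurePreserving h.homeo.toMeasurableEquiv (volume.restrict Ω) (volume.restrict Ω'))
    (hΩΩ' : Φ '' Ω = Ω') (hΩ : IsPrecompact Ω) (hN : IsFrame N N') (z : L2Pair Ω') :
    sobOp Ω Φ N (pullPair _ he z) ∈ smoothPairs Ω ↔ z ∈ smoothPairs Ω' := by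
  constructor
  · rintro ⟨u, hu, hu₁, hu₂⟩
    have hv₀ : IsCkc 1 Ω fun x => N' x (u x) := IsCkc.clm_apply hN.contDiff' hu
    have hv := h.isCkc_comp_symm hv₀
    rw [hΩΩ'] at hv
    obtain ⟨z', hz', h₁, h₂⟩ := hv.exists_mem_smoothPairs
    have e : (fun x => N x (((fun x => N' x (u x)) ∘ h.homeo.symm) (Φ x))) = u := by
      funext x
      simp [hN.apply_apply]
    have := sobPull_of_ae_eq h he hΩ hN hv.contDiff h₁ h₂
    rw [e] at this
    have hzz : sobOp Ω Φ N (pullPair _ he z) = sobOp Ω Φ N (pullPair _ he z') :=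
      L2Pair.ext_ae (hu₁.trans this.1.symm) (hu₂.trans this.2.symm)
    obtain ⟨U, hU⟩ := isUnit_sobOp hΩ h hN
    have hinj : Function.Injective (sobOp Ω Φ N) := by
      rw [← hU]
      exact (ContinuousLinearEquiv.unitsEquiv ℝ _ U).injective
    rwa [(pullPair _ he).injective (hinj hzz)]
  · rintro ⟨v, hv, hv₁, hv₂⟩
    obtain ⟨e₁, e₂⟩ := sobPull_of_ae_eq h he hΩ hN hv.contDiff hv₁ hv₂
    rw [← hΩΩ'] at hv
    exact ⟨_, IsCkc.clm_apply hN.contDiff (h.isCkc_comp hv), e₁, e₂⟩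

/-- The operator is a homeomorphism of the spaces of pairs, so it matches the closures of subspaces
that it matches. No rule for weak derivatives is needed. -/
theorem sobPull_mem_H10_iff (h : IsVolDiffeo Φ)
    (he : MeasurePreserving h.homeo.toMeasurableEquiv (volume.restrict Ω) (volume.restrict Ω'))
    (hΩΩ' : Φ '' Ω = Ω') (hΩ : IsPrecompact Ω) (hN : IsFrame N N') (z : L2Pair Ω') :
    sobOp Ω Φ N (pullPair _ he z) ∈ H10 Ω ↔ z ∈ H10 Ω' := by
  obtain ⟨U, hU⟩ := isUnit_sobOp hΩ h hN
  let E : L2Pair Ω' ≃L[ℝ] L2Pair Ω :=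
    (pullPair _ he).toContinuousLinearEquiv.trans (ContinuousLinearEquiv.unitsEquiv ℝ _ U)
  have hE : ∀ z, E z = sobOp Ω Φ N (pullPair _ he z) := fun z => by rw [← hU]; rfl
  have hpre : E.toHomeomorph ⁻¹' (smoothPairs Ω : Set (L2Pair Ω)) = smoothPairs Ω' := by
    ext z
    change E z ∈ smoothPairs Ω ↔ z ∈ smoothPairs Ω'
    rw [hE]
    exact sobPull_mem_smoothPairs_iff h he hΩΩ' hΩ hN z
  have hcl := E.toHomeomorph.preimage_closure (smoothPairs Ω : Set (L2Pair Ω))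
  rw [hpre] at hcl
  rw [← hE]
  exact Set.ext_iff.1 hcl z

/-- The trace of `DΦ⁻¹ Dv DΦ` is `div v`, and the remaining term of the derivative is traceless by
`clmTrace_fderiv_invDeriv_flip`. -/
theorem sobPull_mem_V_iff (h : IsVolDiffeo Φ)
    (he : MeasurePreserving h.homeo.toMeasurableEquiv (volume.restrict Ω) (volume.restrict Ω'))
    (hΩΩ' : Φ '' Ω = Ω') (hΩ : IsPrecompact Ω) (z : L2Pair Ω') :
    sobOp Ω Φ (invDeriv Φ) (pullPair _ he z) ∈ V Ω ↔ z ∈ V Ω' := by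
  have hN := h.isFrame_invDeriv
  refine and_congr (sobPull_mem_H10_iff h he hΩΩ' hΩ hN z) ?_
  have key : ∀ᵐ x ∂volume.restrict Ω,
      tr ((sobOp Ω Φ (invDeriv Φ) (pullPair _ he z)).snd x) = tr (z.snd (Φ x)) := by
    filter_upwards [sobPull_snd h he hΩ hN z] with x hx
    rw [hx, tr_matEquiv, map_add, h.clmTrace_fderiv_invDeriv_flip, zero_add, clmTrace_mul_comm,
      ContinuousLinearMap.comp_assoc]
    have : fderiv ℝ Φ x ∘L invDeriv Φ x = ContinuousLinearMap.id ℝ _ := h.mul_invDeriv x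
    rw [this, ContinuousLinearMap.comp_id, ← tr_matEquiv, ContinuousLinearEquiv.apply_symm_apply]
  constructor
  · intro hz
    refine h.ae_of_ae_comp he (p := fun y => tr (z.snd y) = 0) ?_
    filter_upwards [key, hz] with x h1 h2
    rw [← h1, h2]
  · intro hz
    filter_upwards [key, h.ae_comp he hz] with x h1 h2
    rw [h1, h2]

/-- Pointwise `(DΦ⁻¹ (u ∘ Φ)) · ∇(q ∘ Φ) = (u · ∇q) ∘ Φ`, because `DΦᵀ` and `DΦ⁻¹` cancel in the
inner product; and `q ↦ q ∘ Φ` is a bijection of the test functions. -/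
theorem pull_mem_H_iff (h : IsVolDiffeo Φ)
    (he : MeasurePreserving h.homeo.toMeasurableEquiv (volume.restrict Ω) (volume.restrict Ω'))
    (hΩΩ' : Φ '' Ω = Ω') (hΩ : IsPrecompact Ω) (u : L2 Ω') :
    mulOp Ω (invDeriv Φ) (pull _ he u) ∈ H Ω ↔ u ∈ H Ω' := by
  have key : ∀ q : Vec d → ℝ, Differentiable ℝ q →
      ∫ y in Ω', inner ℝ (u y) (gradient q y) =
        ∫ x in Ω, inner ℝ (mulOp Ω (invDeriv Φ) (pull _ he u) x) (gradient (q ∘ Φ) x) := by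
    intro q hq
    rw [← he.integral_comp' (fun y => inner ℝ (u y) (gradient q y))]
    refine integral_congr_ae ?_
    filter_upwards [coeFn_mulOp hΩ h.contDiff_invDeriv.continuous (pull _ he u),
      coeFn_pull he u] with x h1 h2
    rw [h1, h2, h.gradient_comp hq, ContinuousLinearMap.adjoint_inner_right,
      h.fderiv_invDeriv_apply]
    rfl
  constructor
  · intro hu q hq
    rw [key q (hq.contDiff.differentiable one_ne_zero)]
    rw [← hΩΩ'] at hq
    exact hu _ (h.isCkc_comp hq)
  · intro hu q hq
    have hq' := h.isCkc_comp_symm hq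
    rw [hΩΩ'] at hq'
    have := key _ (hq'.contDiff.differentiable one_ne_zero)
    have e : (q ∘ h.homeo.symm) ∘ Φ = q := by
      funext x
      simp
    rw [e] at this
    rw [← this]
    exact hu _ hq'

/-- Needed to match the test fields in the definition of `VStar`. The converse cancels the
invertible matrix `DΦᵀ`. -/
theorem sobPull_adjoint_fst_eq_gradient_iff (h : IsVolDiffeo Φ)
    (he : MeasurePreserving h.homeo.toMeasurableEquiv (volume.restrict Ω) (volume.restrict Ω'))
    (hΩ : IsPrecompact Ω) (z : L2Pair Ω')
    {q : Vec d → ℝ} (hq : Differentiable ℝ q) :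
    (sobOp Ω Φ (fun x => ContinuousLinearMap.adjoint (fderiv ℝ Φ x)) (pullPair _ he z)).fst
      =ᵐ[volume.restrict Ω] gradient (q ∘ Φ) ↔ z.fst =ᵐ[volume.restrict Ω'] gradient q := by
  have hN := h.isFrame_invDeriv.adjoint
  have h1 := sobPull_fst h he hΩ hN z
  constructor
  · intro h2
    refine h.ae_of_ae_comp he (p := fun y => z.fst y = gradient q y) ?_
    filter_upwards [h1, h2] with x e1 e2
    rw [e1, h.gradient_comp hq] at e2
    have := congrArg (ContinuousLinearMap.adjoint (invDeriv Φ x)) e2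
    rwa [hN.apply_apply', hN.apply_apply'] at this
  · intro h2
    filter_upwards [h1, h.ae_comp he h2] with x e1 e2
    rw [e1, e2, h.gradient_comp hq]

end Sobolev

/-! ### Families of isomorphisms onto a fixed space -/

section PullFamily

variable {T : ℝ} {X : ℝ → Type*} [∀ t, NormedAddCommGroup (X t)] [∀ t, NormedSpace ℝ (X t)]

/-- Families of isomorphisms `S_t : X(t) → X(0)`, bounded uniformly in `t` and such that the
norms `u ↦ ‖S_t⁻¹ u‖` depend continuously on `t`. -/
structure IsPullFamily (S : ∀ t ∈ Icc 0 T, X t ≃L[ℝ] X 0) : Prop where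
  apply_zero : ∀ h0 : 0 ∈ Icc 0 T, ∀ z, S 0 h0 z = z
  bounded : ∃ C, 0 ≤ C ∧ ∀ t ht, (∀ z, ‖S t ht z‖ ≤ C * ‖z‖) ∧ ∀ u, ‖(S t ht).symm u‖ ≤ C * ‖u‖
  -- The estimate is uniform in `u` on bounded sets; continuity for each single `u` would not pass
  -- to dual norms.
  continuous_norm : ∀ t₀, ∀ h₀ : t₀ ∈ Icc 0 T, ∀ ε > 0, ∀ᶠ t in 𝓝[Icc 0 T] t₀, ∀ ht : t ∈ Icc 0 T,
    ∀ u, |‖(S t ht).symm u‖ - ‖(S t₀ h₀).symm u‖| ≤ ε * ‖u‖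

variable {S : ∀ t ∈ Icc 0 T, X t ≃L[ℝ] X 0}

open Classical in
theorem IsPullFamily.exists_isCompatible (hT : 0 ≤ T) (hS : IsPullFamily S)
    (hX : ∀ t ∈ Icc 0 T, IsSeparableHilbert (X t)) :
    ∃ φ : ∀ t, X 0 → X t, (∀ t ht u, φ t u = (S t ht).symm u) ∧ IsCompatible T X φ := by
  -- The maps are `S_t⁻¹` on `[0,T]`; the value `0` at other times is irrelevant.
  obtain ⟨φ, hφ⟩ : ∃ φ : ∀ t, X 0 → X t, ∀ t ht u, φ t u = (S t ht).symm u :=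
    ⟨fun t u => if ht : t ∈ Icc 0 T then (S t ht).symm u else 0, fun t ht u => dif_pos ht⟩
  refine ⟨φ, hφ, hX, fun u => ?_, ?_, fun u t₀ h₀ => ?_⟩
  · have h0 : (0 : ℝ) ∈ Icc 0 T := ⟨le_rfl, hT⟩
    rw [hφ 0 h0, ContinuousLinearEquiv.symm_apply_eq, hS.apply_zero]
  · obtain ⟨C, hC0, hC⟩ := hS.bounded
    exact ⟨C, fun t ht => ⟨(S t ht).symm, fun u => (hφ t ht u).symm, (hC t ht).2, (hC t ht).1⟩⟩
  · refine Metric.tendsto_nhds.2 fun ε hε => ?_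
    have hδ : 0 < ε / (‖u‖ + 1) := by positivity
    filter_upwards [hS.continuous_norm t₀ h₀ _ hδ, self_mem_nhdsWithin] with t ht htI
    rw [hφ t htI, hφ t₀ h₀, Real.dist_eq]
    refine (ht htI u).trans_lt ?_
    rw [div_mul_eq_mul_div, div_lt_iff₀ (by positivity)]
    nlinarith [norm_nonneg u]

/-- Restriction of an isomorphism to subspaces that correspond to each other. -/
noncomputable def restrictEquiv {Y Z : Type*} [NormedAddCommGroup Y] [NormedSpace ℝ Y]
    [NormedAddCommGroup Z] [NormedSpace ℝ Z] (E : Y ≃L[ℝ] Z) (U : Submodule ℝ Y)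
    (W : Submodule ℝ Z) (h : ∀ y, E y ∈ W ↔ y ∈ U) : U ≃L[ℝ] W where
  toFun u := ⟨E u, (h u).2 u.2⟩
  map_add' u v := Subtype.ext (map_add E u.1 v.1)
  map_smul' c u := Subtype.ext (map_smul E c u.1)
  invFun w := ⟨E.symm w, (h _).1 (by rw [E.apply_symm_apply]; exact w.2)⟩
  left_inv u := Subtype.ext (E.symm_apply_apply u.1)
  right_inv w := Subtype.ext (E.apply_symm_apply w.1)
  continuous_toFun := (E.continuous.comp continuous_subtype_val).subtype_mk _
  continuous_invFun := (E.symm.continuous.comp continuous_subtype_val).subtype_mk _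

/-! ### Passage to dual spaces -/

section Dual

variable {W : ∀ t, Submodule ℝ (StrongDual ℝ (X t))}

/-- The isomorphism `f ↦ f ∘ S⁻¹` of dual spaces. -/
noncomputable def dualEquiv {Y Z : Type*} [NormedAddCommGroup Y] [NormedSpace ℝ Y]
    [NormedAddCommGroup Z] [NormedSpace ℝ Z] (E : Y ≃L[ℝ] Z) :
    StrongDual ℝ Y ≃L[ℝ] StrongDual ℝ Z :=
  E.arrowCongr (ContinuousLinearEquiv.refl ℝ ℝ)

theorem dualEquiv_symm_apply {Y Z : Type*} [NormedAddCommGroup Y] [NormedSpace ℝ Y]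
    [NormedAddCommGroup Z] [NormedSpace ℝ Z] (E : Y ≃L[ℝ] Z) (f : StrongDual ℝ Z) (v : Y) :
    (dualEquiv E).symm f v = f (E v) := rfl

theorem dualEquiv_apply {Y Z : Type*} [NormedAddCommGroup Y] [NormedSpace ℝ Y]
    [NormedAddCommGroup Z] [NormedSpace ℝ Z] (E : Y ≃L[ℝ] Z) (f : StrongDual ℝ Y) (v : Z) :
    dualEquiv E f v = f (E.symm v) := rfl

/-- The functionals `f ∘ E` and `f ∘ E'` live on different spaces and are compared through `f (E v)
= (f ∘ E') (E'⁻¹ E v)`. Here `‖E'⁻¹ E v‖ ≤ ‖v‖ + δ ‖E v‖`, and the two factors `C` come from `‖E v‖`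
and `‖f ∘ E'‖`. -/
theorem norm_dualEquiv_symm_le {Y Y' Z : Type*} [NormedAddCommGroup Y] [NormedSpace ℝ Y]
    [NormedAddCommGroup Y'] [NormedSpace ℝ Y'] [NormedAddCommGroup Z] [NormedSpace ℝ Z]
    (E : Y ≃L[ℝ] Z) (E' : Y' ≃L[ℝ] Z) {C δ : ℝ} (hC0 : 0 ≤ C) (hδ : 0 ≤ δ)
    (hE : ∀ z, ‖E z‖ ≤ C * ‖z‖) (hE' : ∀ z, ‖E' z‖ ≤ C * ‖z‖)
    (h : ∀ u, ‖E'.symm u‖ ≤ ‖E.symm u‖ + δ * ‖u‖) (f : StrongDual ℝ Z) :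
    ‖(dualEquiv E).symm f‖ ≤ ‖(dualEquiv E').symm f‖ + C * C * δ * ‖f‖ := by
  have hf : ‖(dualEquiv E').symm f‖ ≤ C * ‖f‖ :=
    ContinuousLinearMap.opNorm_le_bound _ (by positivity) fun v => by
      rw [dualEquiv_symm_apply]
      calc ‖f (E' v)‖ ≤ ‖f‖ * (C * ‖v‖) := f.le_opNorm_of_le (hE' v)
        _ = _ := by ring
  refine ContinuousLinearMap.opNorm_le_bound _ (by positivity) fun v => ?_
  have h1 : (dualEquiv E).symm f v = (dualEquiv E').symm f (E'.symm (E v)) := by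
    rw [dualEquiv_symm_apply, dualEquiv_symm_apply, ContinuousLinearEquiv.apply_symm_apply]
  have h2 : ‖E'.symm (E v)‖ ≤ ‖v‖ + δ * (C * ‖v‖) := by
    refine (h (E v)).trans ?_
    rw [ContinuousLinearEquiv.symm_apply_apply]
    gcongr
    exact hE v
  rw [h1]
  calc ‖(dualEquiv E').symm f (E'.symm (E v))‖
      ≤ ‖(dualEquiv E').symm f‖ * (‖v‖ + δ * (C * ‖v‖)) :=
        ContinuousLinearMap.le_opNorm_of_le _ h2
    _ = ‖(dualEquiv E').symm f‖ * ‖v‖ + ‖(dualEquiv E').symm f‖ * (δ * (C * ‖v‖)) := by ring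
    _ ≤ ‖(dualEquiv E').symm f‖ * ‖v‖ + C * ‖f‖ * (δ * (C * ‖v‖)) := by gcongr
    _ = _ := by ring

theorem IsPullFamily.dual (hS : IsPullFamily S)
    (hW : ∀ t ht f, dualEquiv (S t ht) f ∈ W 0 ↔ f ∈ W t) :
    IsPullFamily (X := fun t => W t)
      fun t ht => restrictEquiv (dualEquiv (S t ht)) (W t) (W 0) (hW t ht) := by
  obtain ⟨C, hC0, hC⟩ := hS.bounded
  refine ⟨fun h0 f => Subtype.ext ?_, ⟨C, hC0, fun t ht => ⟨fun f => ?_, fun f => ?_⟩⟩,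
    fun t₀ h₀ ε hε => ?_⟩
  · ext v
    change f.1 ((S 0 h0).symm v) = f.1 v
    congr 1
    rw [ContinuousLinearEquiv.symm_apply_eq, hS.apply_zero]
  · change ‖dualEquiv (S t ht) f.1‖ ≤ C * ‖f.1‖
    refine ContinuousLinearMap.opNorm_le_bound _ (by positivity) fun v => ?_
    rw [dualEquiv_apply]
    calc ‖f.1 ((S t ht).symm v)‖ ≤ ‖f.1‖ * (C * ‖v‖) := f.1.le_opNorm_of_le ((hC t ht).2 v)
      _ = _ := by ring
  · change ‖(dualEquiv (S t ht)).symm f.1‖ ≤ C * ‖f.1‖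
    refine ContinuousLinearMap.opNorm_le_bound _ (by positivity) fun v => ?_
    rw [dualEquiv_symm_apply]
    calc ‖f.1 (S t ht v)‖ ≤ ‖f.1‖ * (C * ‖v‖) := f.1.le_opNorm_of_le ((hC t ht).1 v)
      _ = _ := by ring
  -- Chosen so that the error `C² δ ‖f‖` of the comparison, used in both directions, is at most `ε
  -- ‖f‖`.
  · have hδ : 0 < ε / (C * C + 1) := by positivity
    filter_upwards [hS.continuous_norm t₀ h₀ _ hδ] with t ht htI f
    change |‖(dualEquiv (S t htI)).symm f.1‖ - ‖(dualEquiv (S t₀ h₀)).symm f.1‖| ≤ ε * ‖f.1‖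
    have hb : C * C * (ε / (C * C + 1)) * ‖f.1‖ ≤ ε * ‖f.1‖ := by
      gcongr
      rw [mul_div_assoc', div_le_iff₀ (by positivity)]
      nlinarith
    have h1 := norm_dualEquiv_symm_le (S t htI) (S t₀ h₀) hC0 hδ.le (hC t htI).1 (hC t₀ h₀).1
      (fun u => by linarith [(abs_le.1 (ht htI u)).1]) f.1
    have h2 := norm_dualEquiv_symm_le (S t₀ h₀) (S t htI) hC0 hδ.le (hC t₀ h₀).1 (hC t htI).1
      (fun u => by linarith [(abs_le.1 (ht htI u)).2]) f.1
    rw [abs_le]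
    constructor <;> linarith

theorem IsPullFamily.exists_isCompatible_dual (hT : 0 ≤ T) (hS : IsPullFamily S)
    (hW : ∀ t ht f, dualEquiv (S t ht) f ∈ W 0 ↔ f ∈ W t)
    (hX : ∀ t ∈ Icc 0 T, IsSeparableHilbert (W t)) :
    ∃ φ : ∀ t, W 0 → W t, (∀ t ht f v, (φ t f).1 v = f.1 (S t ht v)) ∧
      IsCompatible T (fun t => W t) φ := by
  obtain ⟨φ, hφ, hc⟩ := (hS.dual hW).exists_isCompatible hT hX
  exact ⟨φ, fun t ht f v => by rw [hφ t ht]; rfl, hc⟩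

end Dual

/-! ### Isometries followed by invertible operators on a fixed space -/

section Ambient

variable {Z : ℝ → Type*} [∀ t, NormedAddCommGroup (Z t)] [∀ t, NormedSpace ℝ (Z t)]
  {Q : ℝ → Z 0 →L[ℝ] Z 0}

/-- The composition of an isometry with an invertible operator. -/
noncomputable def unitEquiv {Y Z : Type*} [NormedAddCommGroup Y] [NormedSpace ℝ Y]
    [NormedAddCommGroup Z] [NormedSpace ℝ Z] (J : Y ≃ₗᵢ[ℝ] Z) {Q : Z →L[ℝ] Z} (hQ : IsUnit Q) :
    Y ≃L[ℝ] Z :=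
  J.toContinuousLinearEquiv.trans (ContinuousLinearEquiv.unitsEquiv ℝ Z hQ.unit)

/-- The isometry drops out, so a norm on a moving space becomes the norm of `Q⁻¹ z` in the fixed
space. -/
theorem norm_unitEquiv_symm {Y Z : Type*} [NormedAddCommGroup Y] [NormedSpace ℝ Y]
    [NormedAddCommGroup Z] [NormedSpace ℝ Z] (J : Y ≃ₗᵢ[ℝ] Z) {Q : Z →L[ℝ] Z} (hQ : IsUnit Q)
    (z : Z) : ‖(unitEquiv J hQ).symm z‖ = ‖Ring.inverse Q z‖ := by
  have h1 : Q (J ((unitEquiv J hQ).symm z)) = z := (unitEquiv J hQ).apply_symm_apply z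
  have h2 : Ring.inverse Q (Q (J ((unitEquiv J hQ).symm z))) = J ((unitEquiv J hQ).symm z) :=
    DFunLike.congr_fun (Ring.inverse_mul_cancel Q hQ) _
  rw [h1] at h2
  rw [h2, J.norm_map]

/-- In the Banach algebra of operators on `Z 0` inversion is continuous at units, so `Q_t⁻¹` is norm
continuous along with `Q_t`, and both are bounded on the compact interval. -/
theorem isPullFamily_restrict [CompleteSpace (Z 0)] {U : ∀ t, Submodule ℝ (Z t)}
    (hQ : ContinuousOn Q (Icc 0 T)) (hQu : ∀ t ∈ Icc 0 T, IsUnit (Q t))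
    (J : ∀ t ∈ Icc 0 T, Z t ≃ₗᵢ[ℝ] Z 0)
    (hU : ∀ t ht z, unitEquiv (J t ht) (hQu t ht) z ∈ U 0 ↔ z ∈ U t)
    (h0 : ∀ h0 z, Q 0 (J 0 h0 z) = z) :
    IsPullFamily (X := fun t => U t)
      fun t ht => restrictEquiv (unitEquiv (J t ht) (hQu t ht)) (U t) (U 0) (hU t ht) := by
  have hP : ContinuousOn (fun t => Ring.inverse (Q t)) (Icc 0 T) := fun t ht => by
    obtain ⟨u, hu⟩ := hQu t ht
    exact (hu ▸ NormedRing.inverse_continuousAt u :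
      ContinuousAt Ring.inverse (Q t)).comp_continuousWithinAt (hQ t ht)
  obtain ⟨C₁, hC₁⟩ := isCompact_Icc.exists_bound_of_continuousOn hQ
  obtain ⟨C₂, hC₂⟩ := isCompact_Icc.exists_bound_of_continuousOn hP
  refine ⟨fun h z => Subtype.ext (h0 h z.1), ⟨max (max C₁ C₂) 0, le_max_right _ _,
    fun t ht => ⟨fun z => ?_, fun z => ?_⟩⟩, fun t₀ h₀ ε hε => ?_⟩
  · change ‖Q t (J t ht z.1)‖ ≤ _ * ‖z.1‖
    rw [← (J t ht).norm_map]
    exact (Q t).le_of_opNorm_le ((hC₁ t ht).trans ((le_max_left _ _).trans (le_max_left _ _))) _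
  · change ‖(unitEquiv (J t ht) (hQu t ht)).symm z.1‖ ≤ _ * ‖z.1‖
    rw [norm_unitEquiv_symm]
    exact ContinuousLinearMap.le_of_opNorm_le _
      ((hC₂ t ht).trans ((le_max_right _ _).trans (le_max_left _ _))) _
  · filter_upwards [Metric.tendsto_nhds.1 (hP t₀ h₀) ε hε] with t ht htI u
    change |‖(unitEquiv (J t htI) (hQu t htI)).symm u.1‖
      - ‖(unitEquiv (J t₀ h₀) (hQu t₀ h₀)).symm u.1‖| ≤ ε * ‖u.1‖
    rw [norm_unitEquiv_symm, norm_unitEquiv_symm]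
    refine (abs_norm_sub_norm_le _ _).trans ?_
    rw [← sub_apply]
    rw [dist_eq_norm] at ht
    exact ContinuousLinearMap.le_of_opNorm_le _ ht.le _

theorem exists_isCompatible_restrict [CompleteSpace (Z 0)] {U : ∀ t, Submodule ℝ (Z t)}
    (hT : 0 ≤ T) (hQ : ContinuousOn Q (Icc 0 T)) (hQu : ∀ t ∈ Icc 0 T, IsUnit (Q t))
    (J : ∀ t ∈ Icc 0 T, Z t ≃ₗᵢ[ℝ] Z 0)
    (hU : ∀ t ht z, unitEquiv (J t ht) (hQu t ht) z ∈ U 0 ↔ z ∈ U t)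
    (h0 : ∀ h0 z, Q 0 (J 0 h0 z) = z) (hX : ∀ t ∈ Icc 0 T, IsSeparableHilbert (U t)) :
    ∃ φ : ∀ t, U 0 → U t, (∀ t ht u, Q t (J t ht (φ t u).1) = u.1) ∧
      IsCompatible T (fun t => U t) φ := by
  obtain ⟨φ, hφ, hc⟩ := (isPullFamily_restrict hQ hQu J hU h0).exists_isCompatible hT hX
  refine ⟨φ, fun t ht u => ?_, hc⟩
  rw [hφ t ht]
  exact (unitEquiv (J t ht) (hQu t ht)).apply_symm_apply u.1

end Ambient

end PullFamily

/-! ### Hilbert spaces -/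

section Hilbert

variable {d : ℕ} {Ω : Set (Vec d)}

theorem isSeparableHilbert_of_isClosed {E : Type*} [NormedAddCommGroup E] [InnerProductSpace ℝ E]
    [CompleteSpace E] [SecondCountableTopology E] {U : Submodule ℝ E}
    (hU : IsClosed (U : Set E)) : IsSeparableHilbert U where
  complete := hU.completeSpace_coe
  separable := inferInstance
  inner := ⟨innerₗ U, fun x y => real_inner_comm y x, fun x => real_inner_self_eq_norm_sq x⟩

/-- The Riesz isometry carries inner product and separability from `E` to its dual. -/
theorem isSeparableHilbert_dual_of_isClosed {E : Type*} [NormedAddCommGroup E]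
    [InnerProductSpace ℝ E] [CompleteSpace E] [SecondCountableTopology E]
    {U : Submodule ℝ (StrongDual ℝ E)} (hU : IsClosed (U : Set (StrongDual ℝ E))) :
    IsSeparableHilbert U where
  complete := hU.completeSpace_coe
  separable := by
    have : SecondCountableTopology (StrongDual ℝ E) :=
      (InnerProductSpace.toDual ℝ E).toHomeomorph.symm.isInducing.secondCountableTopology
    infer_instance
  inner := by
    let D : U →ₗ[ℝ] E :=
      (InnerProductSpace.toDual ℝ E).symm.toLinearEquiv.toLinearMap ∘ₗ U.subtype
    refine ⟨(innerₗ E).compl₁₂ D D, fun x y => real_inner_comm (D y) (D x), fun x => ?_⟩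
    refine (real_inner_self_eq_norm_sq (D x)).trans ?_
    have : ‖D x‖ = ‖x‖ := (InnerProductSpace.toDual ℝ E).symm.norm_map x.1
    rw [this]

theorem isClosed_H (Ω : Set (Vec d)) : IsClosed (H Ω : Set (L2 Ω)) := by
  have : (H Ω : Set (L2 Ω)) = ⋂ (q : Vec d → ℝ) (hq : IsCkc 1 Ω q),
      {u : L2 Ω | inner ℝ u (MemLp.toLp _ hq.memLp_gradient : L2 Ω) = 0} := by
    ext u
    simp only [mem_iInter, mem_ofPred_eq, L2.inner_def]
    refine forall₂_congr fun q hq => ?_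
    have e : ∫ x in Ω, inner ℝ (u x) (gradient q x)
        = ∫ x in Ω, inner ℝ (u x) ((MemLp.toLp _ hq.memLp_gradient : L2 Ω) x) := by
      refine integral_congr_ae ?_
      filter_upwards [hq.memLp_gradient.coeFn_toLp] with x hx
      rw [hx]
    rw [e]
  rw [this]
  exact isClosed_iInter fun q => isClosed_iInter fun hq =>
    isClosed_eq (by fun_prop) continuous_const

theorem isClosed_H10 (Ω : Set (Vec d)) : IsClosed (H10 Ω : Set (L2Pair Ω)) :=
  (smoothPairs Ω).isClosed_topologicalClosure

/-- The divergence constraint is the kernel of a bounded operator: multiplication of the second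
component by the constant coefficient `tr`. -/
theorem isClosed_V (hΩ : IsPrecompact Ω) : IsClosed (V Ω : Set (L2Pair Ω)) := by
  let τ : Mat d →L[ℝ] ℝ := LinearMap.toContinuousLinearMap
    (clmTrace ∘ₗ (matEquiv (d := d)).symm.toLinearEquiv.toLinearMap)
  have hτ : ∀ A, τ A = tr A := fun A => by
    change clmTrace (matEquiv.symm A) = tr A
    rw [← tr_matEquiv, ContinuousLinearEquiv.apply_symm_apply]
  have : (V Ω : Set (L2Pair Ω)) =
      (H10 Ω : Set (L2Pair Ω)) ∩ {z : L2Pair Ω | mulOp Ω (fun _ => τ) z.snd = 0} := by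
    ext z
    refine and_congr Iff.rfl ?_
    have h1 := coeFn_mulOp hΩ (continuous_const (y := τ)) z.snd
    rw [mem_ofPred_eq, Lp.eq_zero_iff_ae_eq_zero]
    constructor
    · intro hz
      filter_upwards [h1, hz] with x e1 e2
      rw [e1, hτ, e2, Pi.zero_apply]
    · intro hz
      filter_upwards [h1, hz] with x e1 e2
      rw [← hτ, ← e1, e2, Pi.zero_apply]
  rw [this]
  refine (isClosed_H10 Ω).inter (isClosed_eq ?_ continuous_const)
  exact (mulOp Ω fun _ => τ).continuous.comp (WithLp.sndL 2 ℝ (L2 Ω) (L2Mat Ω)).continuous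

theorem isClosed_VStar (Ω : Set (Vec d)) : IsClosed (VStar Ω : Set (HNeg1 Ω)) := by
  have : (VStar Ω : Set (HNeg1 Ω)) = ⋂ (q : Vec d → ℝ) (_ : IsCkc 1 Ω q) (g : H10 Ω)
      (_ : g.1.fst =ᵐ[volume.restrict Ω] gradient q), {f | f g = 0} := by
    ext f
    simp only [mem_iInter, mem_ofPred_eq]
    rfl
  rw [this]
  exact isClosed_iInter fun q => isClosed_iInter fun _ => isClosed_iInter fun g =>
    isClosed_iInter fun _ => isClosed_eq (by fun_prop) continuous_const

instance : SecondCountableTopology (L2 Ω) :=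
  have : Fact ((2 : ENNReal) ≠ ⊤) := ⟨ENNReal.ofNat_ne_top⟩
  Lp.SecondCountableTopology

instance : SecondCountableTopology (L2Mat Ω) :=
  have : Fact ((2 : ENNReal) ≠ ⊤) := ⟨ENNReal.ofNat_ne_top⟩
  Lp.SecondCountableTopology

instance : SecondCountableTopology (L2Pair Ω) :=
  (WithLp.prodContinuousLinearEquiv 2 ℝ (L2 Ω)
    (L2Mat Ω)).toHomeomorph.isInducing.secondCountableTopology

theorem isSeparableHilbert_H (Ω : Set (Vec d)) : IsSeparableHilbert (H Ω) :=
  isSeparableHilbert_of_isClosed (isClosed_H Ω)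

theorem isSeparableHilbert_V (hΩ : IsPrecompact Ω) : IsSeparableHilbert (V Ω) :=
  isSeparableHilbert_of_isClosed (isClosed_V hΩ)

end Hilbert

/-! ### Continuity in time of the coefficients -/

section Continuity

variable {d : ℕ} {T : ℝ} {w : ℝ → Vec d → Vec d}

namespace IsC2Field

theorem continuousOn_invDeriv_flow (hT : 0 ≤ T) (hw : IsC2Field T w)
    (hv : ∀ t ∈ Icc 0 T, IsVolDiffeo (flow T w t)) :
    ContinuousOn (fun p : ℝ × Vec d => invDeriv (flow T w p.1) p.2) (Icc 0 T ×ˢ univ) := by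
  intro p hp
  obtain ⟨u, hu⟩ := (hv p.1 hp.1).isUnit_fderiv p.2
  exact (hu ▸ NormedRing.inverse_continuousAt u :
    ContinuousAt Ring.inverse (fderiv ℝ (flow T w p.1) p.2)).comp_continuousWithinAt
      (f := fun p : ℝ × Vec d => fderiv ℝ (flow T w p.1) p.2) (hw.continuousOn_fderiv_flow hT p hp)

/-- In finite dimensions continuity may be tested on each vector `k`, where the derivative equals
`-DΦ⁻¹ D²Φ(k) DΦ⁻¹`. -/
theorem continuousOn_fderiv_invDeriv_flow (hT : 0 ≤ T) (hw : IsC2Field T w)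
    (hv : ∀ t ∈ Icc 0 T, IsVolDiffeo (flow T w t)) :
    ContinuousOn (fun p : ℝ × Vec d => fderiv ℝ (invDeriv (flow T w p.1)) p.2)
      (Icc 0 T ×ˢ univ) := by
  refine continuousOn_clm_apply.2 fun k => ?_
  have hi := hw.continuousOn_invDeriv_flow hT hv
  have h2 := (hw.continuousOn_fderiv_fderiv_flow hT).clm_apply (continuousOn_const (c := k))
  exact ((hi.mul h2).mul hi).neg.congr fun p hp => (hv p.1 hp.1).fderiv_invDeriv p.2 k

theorem continuousOn_adjoint_fderiv_flow (hT : 0 ≤ T) (hw : IsC2Field T w) :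
    ContinuousOn (fun p : ℝ × Vec d => ContinuousLinearMap.adjoint (fderiv ℝ (flow T w p.1) p.2))
      (Icc 0 T ×ˢ univ) :=
  (ContinuousLinearMap.adjoint (𝕜 := ℝ) (E := Vec d) (F := Vec d)).continuous.comp_continuousOn
    (hw.continuousOn_fderiv_flow hT)

theorem continuousOn_fderiv_adjoint_fderiv_flow (hT : 0 ≤ T) (hw : IsC2Field T w)
    (hv : ∀ t ∈ Icc 0 T, IsVolDiffeo (flow T w t)) :
    ContinuousOn (fun p : ℝ × Vec d =>
      fderiv ℝ (fun x => ContinuousLinearMap.adjoint (fderiv ℝ (flow T w p.1) x)) p.2)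
      (Icc 0 T ×ˢ univ) := by
  let A : (Vec d →L[ℝ] Vec d) ≃L[ℝ] (Vec d →L[ℝ] Vec d) :=
    (ContinuousLinearMap.adjoint (𝕜 := ℝ) (E := Vec d) (F := Vec d)).toContinuousLinearEquiv
  refine ((continuousOn_const (c := (A : (Vec d →L[ℝ] Vec d) →L[ℝ] (Vec d →L[ℝ] Vec d)))).clm_comp
    (hw.continuousOn_fderiv_fderiv_flow hT)).congr fun p hp => ?_
  exact (A.hasFDerivAt.comp p.2
    (((hv p.1 hp.1).contDiff_fderiv.differentiable one_ne_zero p.2).hasFDerivAt)).fderiv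

theorem continuousOn_sobOp_flow {Ω : Set (Vec d)} (hΩ : IsPrecompact Ω) (hT : 0 ≤ T)
    (hw : IsC2Field T w) {N : ℝ → Vec d → Vec d →L[ℝ] Vec d}
    (hN : ContinuousOn (fun p : ℝ × Vec d => N p.1 p.2) (Icc 0 T ×ˢ univ))
    (hN' : ContinuousOn (fun p : ℝ × Vec d => fderiv ℝ (N p.1) p.2) (Icc 0 T ×ˢ univ)) :
    ContinuousOn (fun t => sobOp Ω (flow T w t) (N t)) (Icc 0 T) :=
  continuousOn_pairOp hΩ hN (continuousOn_matEquiv_flip hN')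
    (continuousOn_matConj hN (hw.continuousOn_fderiv_flow hT))

end IsC2Field

end Continuity

/-! ### Compatibility of the three pairs on the moving domain -/

section Compatible

variable {d : ℕ} {T : ℝ} {w : ℝ → Vec d → Vec d} {Ω₀ : Set (Vec d)} {t : ℝ}

theorem image_movingDomain_zero : flow T w t '' movingDomain T w Ω₀ 0 = movingDomain T w Ω₀ t := by
  rw [movingDomain_zero, movingDomain]

theorem IsPrecompact.image {Ω : Set (Vec d)} {Φ : Vec d → Vec d} (hΩ : IsPrecompact Ω)
    (h : IsVolDiffeo Φ) : IsPrecompact (Φ '' Ω) where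
  measurableSet := h.homeo.measurableEmbedding.measurableSet_image.2 hΩ.measurableSet
  isCompact_closure := by
    have := h.homeo.image_closure Ω
    rw [h.coe_homeo] at this
    rw [← this]
    exact hΩ.isCompact_closure.image h.contDiff.continuous

theorem IsVolDiffeo.measurePreserving_flow (h : IsVolDiffeo (flow T w t)) (hΩ : MeasurableSet Ω₀) :
    MeasurePreserving h.homeo.toMeasurableEquiv (volume.restrict (movingDomain T w Ω₀ 0))
      (volume.restrict (movingDomain T w Ω₀ t)) := by
  rw [movingDomain_zero]
  exact h.measurePreserving hΩ

/-- The maps `φ_t` arise as inverses, that is, from the equation `DΦ⁻¹ (v ∘ Φ) = u`; solving it for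
`v` gives the Piola transform of `u`. -/
theorem IsVolDiffeo.ae_eq_piola_flow (h : IsVolDiffeo (flow T w t)) (hΩ : MeasurableSet Ω₀)
    {u v : Vec d → Vec d} (huv : ∀ᵐ x ∂volume.restrict (movingDomain T w Ω₀ 0),
      invDeriv (flow T w t) x (v (flow T w t x)) = u x) :
    v =ᵐ[volume.restrict (movingDomain T w Ω₀ t)] piola Ω₀ (flow T w t) u := by
  have hm : MeasurableSet (movingDomain T w Ω₀ t) :=
    h.homeo.measurableEmbedding.measurableSet_image.2 hΩ
  have key : ∀ᵐ y ∂volume.restrict (movingDomain T w Ω₀ t),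
      v y = fderiv ℝ (flow T w t) (h.homeo.symm y) (u (h.homeo.symm y)) := by
    refine h.ae_of_ae_comp (h.measurePreserving_flow hΩ) ?_
    filter_upwards [huv] with x hx
    rw [h.homeo_symm_apply, ← hx, h.fderiv_invDeriv_apply]
  filter_upwards [key, ae_restrict_mem hm] with y hy hyΩ
  rw [hy, h.piola_eq hyΩ]

/-- Serves the normalization `φ_0 = Id`: at time zero the frame is constant, so its derivative
vanishes. -/
theorem sobOp_pullPair_of_eq_id {Ω : Set (Vec d)} {Φ : Vec d → Vec d} (h : IsVolDiffeo Φ)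
    (he : MeasurePreserving h.homeo.toMeasurableEquiv (volume.restrict Ω) (volume.restrict Ω))
    (hΩ : IsPrecompact Ω) {N N' : Vec d → Vec d →L[ℝ] Vec d} (hN : IsFrame N N') (hΦ : Φ = id)
    (hN1 : N = fun _ => 1) (z : L2Pair Ω) : sobOp Ω Φ N (pullPair _ he z) = z := by
  subst hΦ hN1
  refine L2Pair.ext_ae ?_ ?_
  · filter_upwards [sobPull_fst h he hΩ hN z] with x hx
    rw [hx]
    rfl
  · filter_upwards [sobPull_snd h he hΩ hN z] with x hx
    rw [hx]
    have e : fderiv ℝ (fun _ : Vec d => (1 : Vec d →L[ℝ] Vec d)) x = 0 := by simp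
    rw [e, fderiv_id]
    change matEquiv (0 + matEquiv.symm (z.snd x)) = z.snd x
    rw [zero_add, ContinuousLinearEquiv.apply_symm_apply]

theorem invDeriv_flow_zero : invDeriv (flow T w 0) = fun _ => 1 := by
  funext x
  rw [flow_zero, invDeriv, fderiv_id]
  exact Ring.inverse_one _

theorem exists_isCompatible_H (hT : 0 ≤ T) (hw : IsC2Field T w)
    (hv : ∀ t ∈ Icc 0 T, IsVolDiffeo (flow T w t)) (hΩ : IsPrecompact Ω₀) :
    ∃ φ : ∀ t : ℝ, H (movingDomain T w Ω₀ 0) → H (movingDomain T w Ω₀ t),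
      IsPiolaH T w Ω₀ φ ∧ IsCompatible T (fun t => H (movingDomain T w Ω₀ t)) φ := by
  have hΩ0 : IsPrecompact (movingDomain T w Ω₀ 0) := by rwa [movingDomain_zero]
  have hi : ∀ t ∈ Icc 0 T, Continuous (invDeriv (flow T w t)) := fun t ht =>
    (hv t ht).contDiff_invDeriv.continuous
  obtain ⟨φ, hφ, hc⟩ := exists_isCompatible_restrict (Z := fun t => L2 (movingDomain T w Ω₀ t))
    (U := fun t => H (movingDomain T w Ω₀ t))
    (Q := fun t => mulOp (movingDomain T w Ω₀ 0) (invDeriv (flow T w t))) hT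
    (continuousOn_mulOp hΩ0 (hw.continuousOn_invDeriv_flow hT hv))
    (fun t ht => isUnit_iff_exists.2 ⟨mulOp _ (fderiv ℝ (flow T w t)),
      mulOp_mulOp_of_inverse hΩ0 (hi t ht) (hv t ht).contDiff_fderiv.continuous
        (hv t ht).invDeriv_mul,
      mulOp_mulOp_of_inverse hΩ0 (hv t ht).contDiff_fderiv.continuous (hi t ht)
        (hv t ht).mul_invDeriv⟩)
    (fun t ht => pull _ ((hv t ht).measurePreserving_flow hΩ.measurableSet))
    (fun t ht z => pull_mem_H_iff (hv t ht) _ image_movingDomain_zero hΩ0 z)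
    (fun h0 z => by
      refine Lp.ext ?_
      filter_upwards [coeFn_mulOp hΩ0 (hi 0 h0)
        (pull _ ((hv 0 h0).measurePreserving_flow hΩ.measurableSet) z),
        coeFn_pull ((hv 0 h0).measurePreserving_flow hΩ.measurableSet) z] with x h1 h2
      have e : (hv 0 h0).homeo.toMeasurableEquiv x = x := congrFun (flow_zero T w) x
      rw [h1, h2, invDeriv_flow_zero, Function.comp_apply, e]
      rfl)
    (fun t _ => isSeparableHilbert_H _)
  refine ⟨φ, fun t ht u => ?_, hc⟩
  refine (hv t ht).ae_eq_piola_flow hΩ.measurableSet ?_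
  rw [← hφ t ht u]
  filter_upwards [coeFn_mulOp hΩ0 (hi t ht)
    (pull _ ((hv t ht).measurePreserving_flow hΩ.measurableSet) (φ t u).1),
    coeFn_pull ((hv t ht).measurePreserving_flow hΩ.measurableSet) (φ t u).1] with x h1 h2
  rw [h1, h2]
  rfl

theorem exists_isCompatible_V (hT : 0 ≤ T) (hw : IsC2Field T w)
    (hv : ∀ t ∈ Icc 0 T, IsVolDiffeo (flow T w t)) (hΩ : IsPrecompact Ω₀) :
    ∃ φ : ∀ t : ℝ, V (movingDomain T w Ω₀ 0) → V (movingDomain T w Ω₀ t),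
      IsPiolaV T w Ω₀ φ ∧ IsCompatible T (fun t => V (movingDomain T w Ω₀ t)) φ := by
  have hΩ0 : IsPrecompact (movingDomain T w Ω₀ 0) := by rwa [movingDomain_zero]
  obtain ⟨φ, hφ, hc⟩ := exists_isCompatible_restrict (Z := fun t => L2Pair (movingDomain T w Ω₀ t))
    (U := fun t => V (movingDomain T w Ω₀ t))
    (Q := fun t => sobOp (movingDomain T w Ω₀ 0) (flow T w t) (invDeriv (flow T w t))) hT
    (hw.continuousOn_sobOp_flow hΩ0 hT (hw.continuousOn_invDeriv_flow hT hv)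
      (hw.continuousOn_fderiv_invDeriv_flow hT hv))
    (fun t ht => isUnit_sobOp hΩ0 (hv t ht) (hv t ht).isFrame_invDeriv)
    (fun t ht => pullPair _ ((hv t ht).measurePreserving_flow hΩ.measurableSet))
    (fun t ht z => sobPull_mem_V_iff (hv t ht) _ image_movingDomain_zero hΩ0 z)
    (fun h0 z => sobOp_pullPair_of_eq_id (hv 0 h0) _ hΩ0 (hv 0 h0).isFrame_invDeriv
      (flow_zero T w) invDeriv_flow_zero z)
    (fun t ht => isSeparableHilbert_V (hΩ.image (hv t ht)))
  refine ⟨φ, fun t ht u => ?_, hc⟩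
  refine (hv t ht).ae_eq_piola_flow hΩ.measurableSet ?_
  rw [← hφ t ht u]
  filter_upwards [sobPull_fst (hv t ht) ((hv t ht).measurePreserving_flow hΩ.measurableSet) hΩ0
    (hv t ht).isFrame_invDeriv (φ t u).1] with x hx
  rw [hx]

/-- Membership means annihilating the gradients in `H¹₀`, and `E` carries these on `Ω'` onto those
on `Ω`. -/
theorem dualEquiv_mem_VStar_iff {Ω Ω' : Set (Vec d)} {Φ : Vec d → Vec d} (h : IsVolDiffeo Φ)
    (he : MeasurePreserving h.homeo.toMeasurableEquiv (volume.restrict Ω) (volume.restrict Ω'))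
    (hΩΩ' : Φ '' Ω = Ω') (hΩ : IsPrecompact Ω) {E : H10 Ω' ≃L[ℝ] H10 Ω}
    (hE : ∀ z, (E z).1 =
      sobOp Ω Φ (fun x => ContinuousLinearMap.adjoint (fderiv ℝ Φ x)) (pullPair _ he z.1))
    (f : HNeg1 Ω') : dualEquiv E f ∈ VStar Ω ↔ f ∈ VStar Ω' := by
  subst hΩΩ'
  constructor
  · intro hf q hq g hg
    have h1 := hf (q ∘ Φ) (h.isCkc_comp hq) (E g) (by
      rw [hE]
      exact (sobPull_adjoint_fst_eq_gradient_iff h he hΩ g.1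
        (hq.contDiff.differentiable one_ne_zero)).2 hg)
    rwa [dualEquiv_apply, ContinuousLinearEquiv.symm_apply_apply] at h1
  · intro hf q hq g hg
    have hq' := h.isCkc_comp_symm hq
    have e : (q ∘ h.homeo.symm) ∘ Φ = q := funext fun x => congrArg q (h.homeo_symm_apply x)
    refine hf _ hq' (E.symm g) ((sobPull_adjoint_fst_eq_gradient_iff h he hΩ _
      (hq'.contDiff.differentiable one_ne_zero)).1 ?_)
    rwa [← hE, ContinuousLinearEquiv.apply_symm_apply, e]

theorem exists_isCompatible_VStar (hT : 0 ≤ T) (hw : IsC2Field T w)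
    (hv : ∀ t ∈ Icc 0 T, IsVolDiffeo (flow T w t)) (hΩ : IsPrecompact Ω₀) :
    ∃ φ : ∀ t : ℝ, VStar (movingDomain T w Ω₀ 0) → VStar (movingDomain T w Ω₀ t),
      IsPiolaVStar T w Ω₀ φ ∧ IsCompatible T (fun t => VStar (movingDomain T w Ω₀ t)) φ := by
  have hΩ0 : IsPrecompact (movingDomain T w Ω₀ 0) := by rwa [movingDomain_zero]
  -- This family on `H¹₀` consists of the covariant transforms `φ_t*`; the maps on `V*` are obtained
  -- by composing functionals with them.
  have hS := isPullFamily_restrict (Z := fun t => L2Pair (movingDomain T w Ω₀ t))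
    (U := fun t => H10 (movingDomain T w Ω₀ t))
    (Q := fun t => sobOp (movingDomain T w Ω₀ 0) (flow T w t)
      fun x => ContinuousLinearMap.adjoint (fderiv ℝ (flow T w t) x))
    (hw.continuousOn_sobOp_flow hΩ0 hT (hw.continuousOn_adjoint_fderiv_flow hT)
      (hw.continuousOn_fderiv_adjoint_fderiv_flow hT hv))
    (fun t ht => isUnit_sobOp hΩ0 (hv t ht) (hv t ht).isFrame_invDeriv.adjoint)
    (fun t ht => pullPair _ ((hv t ht).measurePreserving_flow hΩ.measurableSet))
    (fun t ht z => sobPull_mem_H10_iff (hv t ht) _ image_movingDomain_zero hΩ0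
      (hv t ht).isFrame_invDeriv.adjoint z)
    (fun h0 z => sobOp_pullPair_of_eq_id (hv 0 h0) _ hΩ0 (hv 0 h0).isFrame_invDeriv.adjoint
      (flow_zero T w) (by
        funext x
        rw [flow_zero, fderiv_id]
        exact ContinuousLinearMap.adjoint_id) z)
  obtain ⟨φ, hφ, hc⟩ := hS.exists_isCompatible_dual (W := fun t => VStar (movingDomain T w Ω₀ t)) hT
    (fun t ht f => dualEquiv_mem_VStar_iff (hv t ht) _ image_movingDomain_zero hΩ0
      (fun _ => rfl) f)
    (fun t ht => by
      have : CompleteSpace (H10 (movingDomain T w Ω₀ t)) := (isClosed_H10 _).completeSpace_coe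
      exact isSeparableHilbert_dual_of_isClosed (isClosed_VStar _))
  -- The witness for `φ_t*` is the member of the pull family at time `t`, found by unification with
  -- `hφ t ht`.
  refine ⟨φ, fun t ht => ⟨_, fun v => ?_, hφ t ht⟩, hc⟩
  exact sobPull_fst (hv t ht) ((hv t ht).measurePreserving_flow hΩ.measurableSet) hΩ0
    (hv t ht).isFrame_invDeriv.adjoint v.1

end Compatible

end PiolaFlow

/-! ### The main theorem -/

theorem mainTheorem5 {d : ℕ} (hd : d = 2 ∨ d = 3) {T : ℝ} (hT : 0 < T)
    (D Ω₀ : Set (Vec d)) (hD : IsOpen D) (hDb : Bornology.IsBounded D)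
    (hΩ : IsOpen Ω₀) (hΩc : IsCompact (closure Ω₀)) (hΩD : closure Ω₀ ⊆ D)
    (hΩ2 : HasC2Boundary Ω₀)
    (k : ℕ) (hk : 2 ≤ k) (w : ℝ → Vec d → Vec d) (hw : IsC1Ckc T k D w)
    (hdiv : ∀ t ∈ Set.Icc 0 T, ∀ x ∈ D, tr (jac (w t) x) = 0) :
    (∃ φ : ∀ t : ℝ, VStar (movingDomain T w Ω₀ 0) → VStar (movingDomain T w Ω₀ t),
      IsPiolaVStar T w Ω₀ φ ∧ IsCompatible T (fun t => VStar (movingDomain T w Ω₀ t)) φ) ∧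
    (∃ φ : ∀ t : ℝ, H (movingDomain T w Ω₀ 0) → H (movingDomain T w Ω₀ t),
      IsPiolaH T w Ω₀ φ ∧ IsCompatible T (fun t => H (movingDomain T w Ω₀ t)) φ) ∧
    (∃ φ : ∀ t : ℝ, V (movingDomain T w Ω₀ 0) → V (movingDomain T w Ω₀ t),
      IsPiolaV T w Ω₀ φ ∧ IsCompatible T (fun t => V (movingDomain T w Ω₀ t)) φ) := by
  have hC2 := hw.isC2Field hk hDb
  have hv : ∀ t ∈ Set.Icc 0 T, IsVolDiffeo (flow T w t) := fun t ht =>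
    hC2.isVolDiffeo_flow hT.le (fun _ ht x => hw.clmTrace_fderiv_eq_zero hdiv ht x) ht
  have hΩ0 : IsPrecompact Ω₀ := ⟨hΩ.measurableSet, hΩc⟩
  exact ⟨exists_isCompatible_VStar hT.le hC2 hv hΩ0, exists_isCompatible_H hT.le hC2 hv hΩ0,
    exists_isCompatible_V hT.le hC2 hv hΩ0⟩
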